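/- Let $n\ge 0$ and $d\ge 1$ be integers (for $n<d$ all spaces of matrices of rank $d$ below are empty and the statement is trivial). Let $T_{n,d}=(S^{d-1})^n$ be the product of $n$ unit spheres, a smooth manifold whose points are regarded as matrices $Y\in\mathbb R^{n\times d}$ with rows $Y_1,\dots,Y_n$ of unit length. Let $T^*_{n,d}\subset T_{n,d}$ be the open submanifold of matrices of rank exactly $d$, let the orthogonal group $O_d$ act on it on the right by $(Y,Q)\mapsto YQ$, let $M^*_{n,d}=T^*_{n,d}/O_d$ with the quotient topology, and let $\pi:T^*_{n,d}\to M^*_{n,d}$, $\pi(Y)=[Y]$, be the projection. A smooth structure (maximal smooth atlas) on $M^*_{n,d}$ of dimension $k=n(d-1)-d(d-1)/2$ is called the quotient structure if $\pi$ is a smooth submersion for it. For $Y\in T^*_{n,d}$ let $\mathcal I_Y$ be the set of tuples $I=(i_1<\dots<i_d)$ in $\{1,\dots,n\}$ with $\dim\operatorname{span}\{Y_i: i\in I\}=d$, and let $J(Y)\in\mathcal I_Y$ be its lexicographically smallest element. Put $\mathcal U_Y=\{[Z]\in M^*_{n,d}: J(Y)\in\mathcal I_Z\}$, which is open. Define $\sigma_Y:\mathcal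 U_Y\to T^*_{n,d}$ by $\sigma_Y([Z])=ZQ$, where $\tilde Z\in\mathbb R^{d\times d}$ consists of the rows of $Z$ with indices in $J(Y)$, $\bar Z$ is the Cholesky factor of $\tilde Z\tilde Z^T$ (the lower triangular matrix with positive diagonal such that $\bar Z\bar Z^T=\tilde Z\tilde Z^T$), and $Q=\tilde Z^{-1}\bar Z\in O_d$; this depends only on the orbit $[Z]$. Then: 1. For every $Y\in T^*_{n,d}$, $[Y]\in\mathcal U_Y$ and $\pi\circ\sigma_Y=\mathrm{id}_{\mathcal U_Y}$. 2. The quotient structure on $M^*_{n,d}$ exists and is unique. 3. A smooth structure of dimension $k$ on the topological space $M^*_{n,d}$ is the quotient structure if and only if, for every $Y\in T^*_{n,d}$, the image $\sigma_Y(\mathcal U_Y)$ is an embedded submanifold of $T^*_{n,d}$ and $\sigma_Y:\mathcal U_Y\to\sigma_Y(\mathcal U_Y)$ is a diffeomorphism. -/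

import Mathlib

open scoped Manifold ContDiff

namespace LowRankCorrelation

noncomputable section

/-- The sphere in `ℝ^d` has dimension `d - 1` for `d ≥ 1`. -/
instance factFinrank (d : ℕ) [NeZero d] :
    Fact (Module.finrank ℝ (EuclideanSpace ℝ (Fin d)) = (d - 1) + 1) :=
  ⟨by
    have := NeZero.pos d
    rw [finrank_euclideanSpace_fin]
    omega⟩

/-- `T_{n,d}`, the product of `n` copies of the unit sphere of `ℝ^d`, with the product topology
and the product manifold structure (of Mathlib). -/
abbrev T (n d : ℕ) : Type :=
  Fin n → Metric.sphere (0 : EuclideanSpace ℝ (Fin d)) 1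

/-- The model of the product manifold `T_{n,d}`. -/
abbrev modelT (n d : ℕ) :
    ModelWithCorners ℝ (Fin n → EuclideanSpace ℝ (Fin (d - 1)))
      (ModelPi fun _ : Fin n => EuclideanSpace ℝ (Fin (d - 1))) :=
  ModelWithCorners.pi fun _ : Fin n => 𝓡 (d - 1)

/-- A point of `T_{n,d}` viewed as an `n × d` matrix with unit rows. -/
def mat {n d : ℕ} (Y : T n d) : Matrix (Fin n) (Fin d) ℝ :=
  Matrix.of fun i j => (Y i : EuclideanSpace ℝ (Fin d)) j

theorem mat_injective {n d : ℕ} : Function.Injective (mat : T n d → _) := by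
  intro Y Z h
  funext i
  apply Subtype.ext
  ext j
  exact congrFun (congrFun h i) j

theorem continuous_mat {n d : ℕ} : Continuous (mat : T n d → _) := by
  refine continuous_matrix fun i j => ?_
  have h : Continuous fun Y : T n d => (Y i : EuclideanSpace ℝ (Fin d)) :=
    continuous_subtype_val.comp (continuous_apply i)
  exact (PiLp.continuous_apply 2 _ j).comp h

theorem row_dot_self {n d : ℕ} (Y : T n d) (i : Fin n) : (mat Y * (mat Y).transpose) i i = 1 := by
  have h : ‖(Y i : EuclideanSpace ℝ (Fin d))‖ = 1 := by simp
  have h2 := EuclideanSpace.real_norm_sq_eq (Y i : EuclideanSpace ℝ (Fin d))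
  rw [h, one_pow] at h2
  simp only [Matrix.mul_apply, Matrix.transpose_apply, mat, Matrix.of_apply]
  refine Eq.trans ?_ h2.symm
  exact Finset.sum_congr rfl fun j _ => (sq _).symm

/-- The point of `T_{n,d}` given by a matrix with unit rows. -/
def ofMat {n d : ℕ} (A : Matrix (Fin n) (Fin d) ℝ) (hA : ∀ i, (A * A.transpose) i i = 1) :
    T n d :=
  fun i => ⟨WithLp.toLp 2 (A i), by
    have h2 := EuclideanSpace.real_norm_sq_eq (WithLp.toLp 2 (A i))
    have h := hA i
    simp only [Matrix.mul_apply, Matrix.transpose_apply] at h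
    have h3 : ‖(WithLp.toLp 2 (A i) : EuclideanSpace ℝ (Fin d))‖ ^ 2 = 1 := by
      rw [h2, ← h]
      exact Finset.sum_congr rfl fun j _ => sq _
    rw [mem_sphere_zero_iff_norm]
    exact (pow_eq_one_iff_of_nonneg (norm_nonneg _) two_ne_zero).1 h3⟩

@[simp] theorem mat_ofMat {n d : ℕ} (A : Matrix (Fin n) (Fin d) ℝ)
    (hA : ∀ i, (A * A.transpose) i i = 1) : mat (ofMat A hA) = A := rfl

theorem rank_eq_iff {n d : ℕ} (A : Matrix (Fin n) (Fin d) ℝ) :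
    A.rank = d ↔ (A.transpose * A).det ≠ 0 := by
  rw [← Matrix.rank_transpose_mul_self, ← isUnit_iff_ne_zero, ← Matrix.isUnit_iff_isUnit_det]
  constructor
  · intro h
    rw [← Matrix.linearIndependent_cols_iff_isUnit, linearIndependent_iff_card_eq_finrank_span,
      Set.finrank, ← Matrix.rank_eq_finrank_span_cols, h, Fintype.card_fin]
  · intro h
    rw [Matrix.rank_of_isUnit _ h, Fintype.card_fin]

/-- `T*_{n,d}`, the open submanifold of `T_{n,d}` of the matrices of rank exactly `d`. -/
def rankLocus (n d : ℕ) : TopologicalSpace.Opens (T n d) :=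
  ⟨{Y | (mat Y).rank = d}, by
    simp only [rank_eq_iff]
    exact isOpen_ne_fun
      ((continuous_mat.matrix_transpose.matrix_mul continuous_mat).matrix_det) continuous_const⟩

/-- `T*_{n,d}` as a type; its topology and charts are those of an open subset of `T_{n,d}`. -/
abbrev TStar (n d : ℕ) : Type := rankLocus n d

/-- `Y` and `Z` lie in the same orbit of the right action `(Y, Q) ↦ Y Q` of `O_d` on `T*_{n,d}`. -/
def orbitSetoid (n d : ℕ) : Setoid (TStar n d) where
  r Y Z := ∃ Q ∈ Matrix.orthogonalGroup (Fin d) ℝ, mat Z.1 = mat Y.1 * Q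
  iseqv :=
    { refl := fun Y => ⟨1, one_mem _, by simp⟩
      symm := by
        rintro Y Z ⟨Q, hQ, h⟩
        refine ⟨star Q, Unitary.star_mem hQ, ?_⟩
        have h1 : Q * star Q = 1 := (Matrix.mem_orthogonalGroup_iff (Fin d) ℝ).1 hQ
        rw [h, Matrix.mul_assoc, h1, Matrix.mul_one]
      trans := by
        rintro X Y Z ⟨Q, hQ, h⟩ ⟨R, hR, h'⟩
        exact ⟨Q * R, mul_mem hQ hR, by rw [h', h, Matrix.mul_assoc]⟩ }

/-- `M*_{n,d} = T*_{n,d} / O_d`, with the quotient topology. -/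
def MStar (n d : ℕ) : Type := Quotient (orbitSetoid n d)

instance (n d : ℕ) : TopologicalSpace (MStar n d) :=
  inferInstanceAs (TopologicalSpace (Quotient (orbitSetoid n d)))

/-- The canonical projection `Y ↦ [Y]`. -/
def proj {n d : ℕ} (Y : TStar n d) : MStar n d := Quotient.mk (orbitSetoid n d) Y

/-- The dimension `n (d - 1) - d (d - 1) / 2` of `M*_{n,d}`. -/
abbrev dimM (n d : ℕ) : ℕ := n * (d - 1) - d * (d - 1) / 2

/-- `𝓘_Y`: the index sets `I` of `d` elements, written as increasing tuples `(i_1, …, i_d)`, such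
that the rows `Y_i`, `i ∈ I`, span a space of dimension `d`. The tuples carry the lexicographical
order. -/
def indexSets {n d : ℕ} (Y : TStar n d) : Set (Lex (Fin d → Fin n)) :=
  {I | StrictMono (ofLex I) ∧
    Module.finrank ℝ (Submodule.span ℝ (Set.range fun i => (mat Y.1).row (ofLex I i))) = d}

theorem indexSets_nonempty {n d : ℕ} (Y : TStar n d) : (indexSets Y).Nonempty := by
  have hY : (mat Y.1).rank = d := Y.2
  rw [Matrix.rank_eq_finrank_span_row] at hY
  obtain ⟨κ, a, ha, hs, hl⟩ := exists_linearIndependent' ℝ (mat Y.1).row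
  have : Finite κ := Finite.of_injective a ha
  have : Fintype κ := Fintype.ofFinite κ
  have hcard : Fintype.card κ = d := by
    have h := linearIndependent_iff_card_eq_finrank_span.1 hl
    rw [Set.finrank, hs, hY] at h
    exact h
  classical
  let s : Finset (Fin n) := Finset.univ.map ⟨a, ha⟩
  have hsc : s.card = d := by simp [s, hcard]
  refine ⟨toLex (s.orderEmbOfFin hsc), (s.orderEmbOfFin hsc).strictMono, ?_⟩
  have hr : (Set.range fun i => (mat Y.1).row (s.orderEmbOfFin hsc i)) =
      Set.range ((mat Y.1).row ∘ a) := by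
    have h1 : Set.range (s.orderEmbOfFin hsc) = Set.range a := by
      rw [Finset.range_orderEmbOfFin]
      simp [s]
    rw [Set.range_comp, ← h1, ← Set.range_comp]
    rfl
  change Module.finrank ℝ (Submodule.span ℝ
    (Set.range fun i => (mat Y.1).row (s.orderEmbOfFin hsc i))) = d
  rw [hr, hs, hY]

/-- `J(Y)`, the lexicographically smallest element of `𝓘_Y`. -/
def lexMin {n d : ℕ} (Y : TStar n d) : Lex (Fin d → Fin n) :=
  WellFounded.min (wellFounded_lt (α := Lex (Fin d → Fin n))) (indexSets Y) (indexSets_nonempty Y)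

/-- The `d × d` matrix formed by the rows of `Z` with indices in the tuple `I`. -/
def rows {n d : ℕ} (I : Lex (Fin d → Fin n)) (Z : TStar n d) : Matrix (Fin d) (Fin d) ℝ :=
  (mat Z.1).submatrix (ofLex I) id

theorem mem_indexSets_iff {n d : ℕ} (I : Lex (Fin d → Fin n)) (Z : TStar n d) :
    I ∈ indexSets Z ↔ StrictMono (ofLex I) ∧ IsUnit (rows I Z).det := by
  rw [indexSets, Set.mem_ofPred_eq, ← Matrix.isUnit_iff_isUnit_det,
    ← Matrix.linearIndependent_rows_iff_isUnit, linearIndependent_iff_card_eq_finrank_span,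
    Fintype.card_fin, Set.finrank, eq_comm (a := d)]
  rfl

theorem rows_mul {n d : ℕ} (I : Lex (Fin d → Fin n)) {Z W : TStar n d}
    {Q : Matrix (Fin d) (Fin d) ℝ} (h : mat W.1 = mat Z.1 * Q) : rows I W = rows I Z * Q := by
  unfold rows
  rw [h]
  rfl

theorem mem_indexSets_of_rel {n d : ℕ} (I : Lex (Fin d → Fin n)) {Z W : TStar n d}
    (h : orbitSetoid n d Z W) (hI : I ∈ indexSets Z) : I ∈ indexSets W := by
  obtain ⟨Q, hQ, h⟩ := h
  rw [mem_indexSets_iff] at hI ⊢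
  refine ⟨hI.1, ?_⟩
  rw [rows_mul I h, Matrix.det_mul]
  refine hI.2.mul ?_
  rw [← Matrix.isUnit_iff_isUnit_det]
  exact .of_mul_eq_one _ ((Matrix.mem_orthogonalGroup_iff (Fin d) ℝ).1 hQ)

theorem continuous_rows {n d : ℕ} (I : Lex (Fin d → Fin n)) :
    Continuous (rows I : TStar n d → _) :=
  (continuous_mat.comp continuous_subtype_val).matrix_submatrix _ _

/-- `𝓤_Y = {[Z] : J(Y) ∈ 𝓘_Z}`, an open subset of `M*_{n,d}`. -/
def chartDomain {n d : ℕ} (Y : TStar n d) : TopologicalSpace.Opens (MStar n d) :=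
  ⟨{p | ∃ Z : TStar n d, proj Z = p ∧ lexMin Y ∈ indexSets Z}, by
    have hq : Topology.IsQuotientMap (proj : TStar n d → MStar n d) := isQuotientMap_quot_mk
    rw [← hq.isOpen_preimage]
    have hpre : (proj : TStar n d → MStar n d) ⁻¹'
        {p | ∃ Z : TStar n d, proj Z = p ∧ lexMin Y ∈ indexSets Z} =
        {Z | lexMin Y ∈ indexSets Z} := by
      ext W
      constructor
      · rintro ⟨Z, hZ, h⟩
        exact mem_indexSets_of_rel _ (Quotient.exact hZ) h
      · intro h
        exact ⟨W, rfl, h⟩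
    rw [hpre]
    simp only [mem_indexSets_iff, isUnit_iff_ne_zero]
    exact isOpen_const.and (isOpen_ne_fun (continuous_rows _).matrix_det continuous_const)⟩

/-- `L` is a Cholesky factor of `X`: lower triangular with positive diagonal and `L Lᵀ = X`. -/
structure IsCholeskyFactor {d : ℕ} (X L : Matrix (Fin d) (Fin d) ℝ) : Prop where
  lower : ∀ i j, i < j → L i j = 0
  pos : ∀ i, 0 < L i i
  mul_transpose : L * L.transpose = X

theorem exists_choleskyFactor {d : ℕ} (A : Matrix (Fin d) (Fin d) ℝ) (hA : IsUnit A.det) :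
    ∃ L, IsCholeskyFactor (A * A.transpose) L := by
  let f : Fin d → EuclideanSpace ℝ (Fin d) := fun i => WithLp.toLp 2 (A i)
  have hf : LinearIndependent ℝ f := by
    rw [← Matrix.isUnit_iff_isUnit_det, ← Matrix.linearIndependent_rows_iff_isUnit] at hA
    exact hA.map' (WithLp.linearEquiv 2 ℝ (Fin d → ℝ)).symm.toLinearMap (LinearEquiv.ker _)
  have hc : Module.finrank ℝ (EuclideanSpace ℝ (Fin d)) = Fintype.card (Fin d) := by simp
  let e := InnerProductSpace.gramSchmidtOrthonormalBasis hc f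
  refine ⟨Matrix.of fun i j => inner ℝ (e j) (f i), ⟨?_, ?_, ?_⟩⟩
  · intro i j hij
    exact InnerProductSpace.gramSchmidtOrthonormalBasis_inv_triangular hc f hij
  · intro i
    have h0 := InnerProductSpace.gramSchmidt_ne_zero (𝕜 := ℝ) i hf
    have hn : InnerProductSpace.gramSchmidtNormed ℝ f i ≠ 0 := by
      intro h
      have := InnerProductSpace.gramSchmidtNormed_unit_length (𝕜 := ℝ) i hf
      rw [h, norm_zero] at this
      exact zero_ne_one this
    simp only [Matrix.of_apply, e]
    rw [InnerProductSpace.gramSchmidtOrthonormalBasis_apply hc hn,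
      InnerProductSpace.gramSchmidtNormed]
    have h1 : inner ℝ (InnerProductSpace.gramSchmidt ℝ f i) (f i) =
        ‖InnerProductSpace.gramSchmidt ℝ f i‖ ^ 2 := by
      conv_lhs => rw [InnerProductSpace.gramSchmidt_def'' ℝ f i]
      rw [inner_add_right, inner_sum, real_inner_self_eq_norm_sq, Finset.sum_eq_zero, add_zero]
      intro j hj
      rw [inner_smul_right, InnerProductSpace.gramSchmidt_orthogonal ℝ f
        (Finset.mem_Iio.1 hj).ne', mul_zero]
    rw [inner_smul_left, h1]
    have := norm_pos_iff.2 h0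
    simp only [RCLike.ofReal_real_eq_id, id_eq, map_inv₀, conj_trivial]
    positivity
  · ext i j
    have h := e.sum_inner_mul_inner (f i) (f j)
    simp only [Matrix.mul_apply, Matrix.transpose_apply, Matrix.of_apply]
    calc _ = ∑ k, inner ℝ (f i) (e k) * inner ℝ (e k) (f j) :=
          Finset.sum_congr rfl fun k _ => by rw [real_inner_comm]
      _ = inner ℝ (f i) (f j) := h
      _ = _ := by
          simp only [PiLp.inner_apply, f]
          exact Finset.sum_congr rfl fun k _ => by simp [mul_comm]

open Classical in
/-- The Cholesky factor of `X` (used only for positive definite `X`, where it exists and is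
unique). -/
def cholesky {d : ℕ} (X : Matrix (Fin d) (Fin d) ℝ) : Matrix (Fin d) (Fin d) ℝ :=
  if h : ∃ L, IsCholeskyFactor X L then h.choose else 0

theorem isCholeskyFactor_cholesky {d : ℕ} (A : Matrix (Fin d) (Fin d) ℝ) (hA : IsUnit A.det) :
    IsCholeskyFactor (A * A.transpose) (cholesky (A * A.transpose)) := by
  have h := exists_choleskyFactor A hA
  rw [cholesky, dif_pos h]
  exact h.choose_spec

/-- The matrix `Q` with `Z̃ Q = Z̄`, where `Z̃` consists of the rows of `Z` with indices in `I` and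
`Z̄` is the Cholesky factor of `Z̃ Z̃ᵀ`. -/
def rotation {n d : ℕ} (I : Lex (Fin d → Fin n)) (Z : TStar n d) : Matrix (Fin d) (Fin d) ℝ :=
  (rows I Z)⁻¹ * cholesky (rows I Z * (rows I Z).transpose)

theorem rotation_mem {n d : ℕ} {I : Lex (Fin d → Fin n)} {Z : TStar n d} (h : I ∈ indexSets Z) :
    rotation I Z ∈ Matrix.orthogonalGroup (Fin d) ℝ := by
  have hu := ((mem_indexSets_iff I Z).1 h).2
  have hc := (isCholeskyFactor_cholesky _ hu).mul_transpose
  rw [Matrix.mem_orthogonalGroup_iff]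
  change rotation I Z * (rotation I Z).transpose = 1
  unfold rotation
  rw [Matrix.transpose_mul, Matrix.mul_assoc, ← Matrix.mul_assoc (cholesky _), hc,
    Matrix.mul_assoc (rows I Z), ← Matrix.transpose_mul, Matrix.nonsing_inv_mul _ hu,
    Matrix.transpose_one, Matrix.mul_one, Matrix.nonsing_inv_mul _ hu]

theorem rows_mul_rotation {n d : ℕ} {I : Lex (Fin d → Fin n)} {Z : TStar n d}
    (h : I ∈ indexSets Z) :
    rows I Z * rotation I Z = cholesky (rows I Z * (rows I Z).transpose) :=
  Matrix.mul_nonsing_inv_cancel_left _ _ ((mem_indexSets_iff I Z).1 h).2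

/-- Right multiplication of a point of `T*_{n,d}` by an orthogonal matrix. -/
def act {n d : ℕ} (Z : TStar n d) (Q : Matrix (Fin d) (Fin d) ℝ)
    (hQ : Q ∈ Matrix.orthogonalGroup (Fin d) ℝ) : TStar n d :=
  ⟨ofMat (mat Z.1 * Q) (by
      intro i
      have h : Q * Q.transpose = 1 := (Matrix.mem_orthogonalGroup_iff (Fin d) ℝ).1 hQ
      rw [Matrix.transpose_mul, Matrix.mul_assoc, ← Matrix.mul_assoc Q, h, Matrix.one_mul]
      exact row_dot_self Z.1 i), by
    have hZ : (mat Z.1).rank = d := Z.2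
    change (mat Z.1 * Q).rank = d
    rw [Matrix.rank_mul_eq_left_of_isUnit_det, hZ]
    rw [← Matrix.isUnit_iff_isUnit_det]
    exact .of_mul_eq_one _ ((Matrix.mem_orthogonalGroup_iff (Fin d) ℝ).1 hQ)⟩

/-- The representative `Z* = Z Q` of the orbit of `Z` relative to the index tuple `I ∈ 𝓘_Z`. -/
def normalForm {n d : ℕ} (I : Lex (Fin d → Fin n)) (Z : TStar n d) (h : I ∈ indexSets Z) :
    TStar n d :=
  act Z (rotation I Z) (rotation_mem h)

theorem normalForm_eq_of_rel {n d : ℕ} (I : Lex (Fin d → Fin n)) {Z W : TStar n d}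
    (hZ : I ∈ indexSets Z) (hW : I ∈ indexSets W) (h : orbitSetoid n d Z W) :
    normalForm I Z hZ = normalForm I W hW := by
  obtain ⟨Q, hQ, h⟩ := h
  have hQ1 : Q * Q.transpose = 1 := (Matrix.mem_orthogonalGroup_iff (Fin d) ℝ).1 hQ
  have hr := rows_mul I h
  have hX : rows I W * (rows I W).transpose = rows I Z * (rows I Z).transpose := by
    rw [hr, Matrix.transpose_mul, Matrix.mul_assoc, ← Matrix.mul_assoc Q, hQ1, Matrix.one_mul]
  apply Subtype.ext
  apply mat_injective
  change mat Z.1 * rotation I Z = mat W.1 * rotation I W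
  have hQu : IsUnit Q.det := by
    rw [← Matrix.isUnit_iff_isUnit_det]
    exact .of_mul_eq_one _ hQ1
  unfold rotation
  rw [hX, hr, h, Matrix.mul_inv_rev, Matrix.mul_assoc, Matrix.mul_assoc,
    Matrix.mul_nonsing_inv_cancel_left _ _ hQu]

/-- The section `σ_Y : 𝓤_Y → T*_{n,d}`, `[Z] ↦ Z*`, where `Z*` is formed with the index tuple
`J(Y)`. By `sec_proj` the value does not depend on the representative `Z`. -/
def sec {n d : ℕ} (Y : TStar n d) (p : chartDomain Y) : TStar n d :=
  normalForm (lexMin Y) p.2.choose p.2.choose_spec.2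

theorem sec_proj {n d : ℕ} (Y Z : TStar n d) (h : lexMin Y ∈ indexSets Z) :
    sec Y ⟨proj Z, Z, rfl, h⟩ = normalForm (lexMin Y) Z h :=
  normalForm_eq_of_rel _ _ _ (Quotient.exact (Exists.choose_spec
    (⟨Z, rfl, h⟩ : ∃ W : TStar n d, proj W = proj Z ∧ lexMin Y ∈ indexSets W)).1)

/-- The atlases of dimension `n (d - 1) - d (d - 1) / 2` on the topological space `M*_{n,d}`. -/
abbrev AtlasM (n d : ℕ) : Type :=
  ChartedSpace (EuclideanSpace ℝ (Fin (dimM n d))) (MStar n d)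

/-- The atlas `c` is a smooth atlas. -/
def IsSmoothAtlas {n d : ℕ} (c : AtlasM n d) : Prop :=
  letI := c
  IsManifold (𝓡 (dimM n d)) ∞ (MStar n d)

/-- The differentiable structure defined by the atlas `c`: the set of all charts that are smoothly
compatible with `c`. -/
def diffStructure {n d : ℕ} (c : AtlasM n d) :
    Set (OpenPartialHomeomorph (MStar n d) (EuclideanSpace ℝ (Fin (dimM n d)))) :=
  letI := c
  IsManifold.maximalAtlas (𝓡 (dimM n d)) ∞ (MStar n d)

/-- The smooth atlas `c` defines the quotient manifold structure of `M*_{n,d} = T*_{n,d} / O_d`: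
the canonical projection is a smooth submersion. -/
def IsQuotientAtlas {n d : ℕ} [NeZero d] (c : AtlasM n d) : Prop :=
  letI := c
  IsSmoothAtlas c ∧
    Manifold.IsSubmersion (modelT n d) (𝓡 (dimM n d)) ∞ (proj : TStar n d → MStar n d)

/-- With respect to the atlas `c` on `M*_{n,d}`, the image `σ_Y(𝓤_Y)` is an embedded submanifold
of `T*_{n,d}` and `σ_Y : 𝓤_Y → σ_Y(𝓤_Y)` is a diffeomorphism. -/
def SectionIsDiffeo {n d : ℕ} [NeZero d] (c : AtlasM n d) (Y : TStar n d) : Prop :=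
  letI := c
  ∃ _ : ChartedSpace (EuclideanSpace ℝ (Fin (dimM n d))) (Set.range (sec Y)),
    IsManifold (𝓡 (dimM n d)) ∞ (Set.range (sec Y)) ∧
    Manifold.IsSmoothEmbedding (𝓡 (dimM n d)) (modelT n d) ∞
      (Subtype.val : Set.range (sec Y) → TStar n d) ∧
    ∃ Φ : Diffeomorph (𝓡 (dimM n d)) (𝓡 (dimM n d)) (chartDomain Y) (Set.range (sec Y)) ∞,
      ∀ p, (Φ p : TStar n d) = sec Y p

end

end LowRankCorrelation

open LowRankCorrelation

open scoped Manifold ContDiff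

/-! Fix an index tuple `J`. Where the rows of `Z` with indices in `J` are independent, Cholesky
factorization selects one representative per orbit: `Z = S Rᵀ` with `R` orthogonal and the `J`-rows
of `S` lower triangular with positive diagonal. Uniqueness of the Cholesky factor makes `S` and `R`
functions of `Z` (`rotation_eq_of_isNormal`). They are smooth, since the Cholesky recursion uses
only rational operations and square roots of positive numbers (`EntrySmoothAt.cholesky`). So this
part of `T*` is a slice times `O_d`, and `π` forgets the second factor.

To get charts, choose in each row of `S` a nonzero pivot entry; unit length and a fixed sign recover
it from the rest of the row. The entries above the `J`-diagonal vanish. The remaining free entries,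
exactly `dimM n d` of them, are coordinates on the quotient (`RowData.freeChart`). The Cayley
transform of `R` relative to a reference rotation supplies the other `d (d - 1) / 2` coordinates of
a chart of `T*` (`RowData.prodChart`). In these charts `π` is a linear projection, and for the
reference rotation `1` the image of the section is the slice on which the Cayley coordinates vanish.

The free-entry charts therefore form a quotient structure. Smoothness descends along submersions
(`contMDiffAt_of_comp_submersion`), so the identity between two quotient structures is smooth both
ways, which is uniqueness. The slice picture gives the section property for the quotient structure.
Conversely, if all sections are diffeomorphisms onto embedded submanifolds, then `π` is locally the
inverse of a section after the normal form, hence smooth. Moreover, any `g` with `g ∘ π` smooth is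
locally `(g ∘ π) ∘ σ`, hence smooth. These two facts identify the structure with the one already
built. -/

namespace LowRankCorrelation

noncomputable section

/-! ### Finite products of manifolds -/

section Pi

open Set

variable {𝕜 : Type*} [NontriviallyNormedField 𝕜] {ι : Type*} [Fintype ι]
  {E : ι → Type*} [∀ i, NormedAddCommGroup (E i)] [∀ i, NormedSpace 𝕜 (E i)]
  {H : ι → Type*} [∀ i, TopologicalSpace (H i)] {I : ∀ i, ModelWithCorners 𝕜 (E i) (H i)}
  {M : ι → Type*} [∀ i, TopologicalSpace (M i)] [∀ i, ChartedSpace (H i) (M i)]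
  {k : WithTop ℕ∞}

/-- A finite product of `C^k` manifolds is a `C^k` manifold. -/
instance isManifold_pi [∀ i, IsManifold (I i) k (M i)] :
    IsManifold (ModelWithCorners.pi I) k (∀ i, M i) := by
  refine isManifold_of_contDiffOn _ _ _ ?_
  rintro _ _ ⟨e, he, rfl⟩ ⟨e', he', rfl⟩
  rw [contDiffOn_pi]
  intro i
  have h := (contDiffGroupoid k (I i)).compatible (he i (mem_univ i)) (he' i (mem_univ i))
  rw [contDiffGroupoid, mem_groupoid_of_pregroupoid] at h
  have h1 : ContDiffOn 𝕜 k (I i ∘ ((e i).symm.trans (e' i)) ∘ (I i).symm)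
    ((I i).symm ⁻¹' ((e i).symm.trans (e' i)).source ∩ range (I i)) := h.1
  refine h1.comp (contDiff_pi.1 contDiff_id i).contDiffOn ?_
  rintro x ⟨hx, y, rfl⟩
  refine ⟨⟨hx.1 i (mem_univ i), hx.2 i (mem_univ i)⟩, mem_range_self (y i)⟩

instance boundaryless_pi [∀ i, (I i).Boundaryless] : (ModelWithCorners.pi I).Boundaryless := by
  constructor
  refine eq_univ_of_forall fun x => ?_
  have h : ∀ i, ∃ y, I i y = x i := fun i => by
    have := (I i).range_eq_univ
    exact (this ▸ mem_univ (x i) : x i ∈ range (I i))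
  choose y hy using h
  exact ⟨y, funext hy⟩

variable {E' H' X : Type*} [NormedAddCommGroup E'] [NormedSpace 𝕜 E'] [TopologicalSpace H']
  {I' : ModelWithCorners 𝕜 E' H'} [TopologicalSpace X] [ChartedSpace H' X]

/-- A map into a finite product of manifolds is `C^k` at a point iff its components are. -/
theorem contMDiffAt_pi_iff {f : X → ∀ i, M i} {x : X} :
    ContMDiffAt I' (ModelWithCorners.pi I) k f x ↔
      ∀ i, ContMDiffAt I' (I i) k (fun y => f y i) x := by
  simp only [contMDiffAt_iff, continuousAt_pi, forall_and]
  refine and_congr_right fun _ => ?_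
  rw [contDiffWithinAt_pi]
  rfl

end Pi

/-! ### Smooth maps into spheres -/

section Sphere

open Metric Module

variable {E : Type*} [NormedAddCommGroup E] [InnerProductSpace ℝ E] {n : ℕ}
  [Fact (finrank ℝ E = n + 1)] {k : WithTop ℕ∞}
  {F H X : Type*} [NormedAddCommGroup F] [NormedSpace ℝ F] [TopologicalSpace H]
  {I : ModelWithCorners ℝ F H} [TopologicalSpace X] [ChartedSpace H X]

/-- A map into the sphere is `C^k` at a point iff it is so as a map into the ambient space. -/
theorem contMDiffAt_sphere_iff {f : X → sphere (0 : E) 1} {x : X} :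
    ContMDiffAt I (𝓡 n) k f x ↔ ContMDiffAt I 𝓘(ℝ, E) k (fun y => (f y : E)) x := by
  refine ⟨fun h => (contMDiff_coe_sphere _).comp x h, fun h => ?_⟩
  rw [contMDiffAt_iff_target]
  refine ⟨Topology.IsInducing.subtypeVal.continuousAt_iff.2 h.continuousAt, ?_⟩
  -- The chart of the sphere at `f x` is stereographic projection from `-f x`. Its formula is smooth
  -- on the ambient open set where the inner product with `-f x` is not `1`, and at `f x` that
  -- product is `-1`.
  let v := f x
  let U : _ ≃ₗᵢ[ℝ] _ :=
    (OrthonormalBasis.fromOrthogonalSpanSingleton (𝕜 := ℝ)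
        n (ne_zero_of_mem_unit_sphere (-v))).repr
  have hU : ContDiffOn ℝ ω _ Set.univ := U.contDiff.contDiffOn
  have H₁ := ((hU.comp_inter contDiffOn_stereoToFun).contMDiffOn).of_le (le_top : k ≤ ω)
  refine (H₁.contMDiffAt (x := (f x : E)) ?_).comp x (f := fun y => (f y : E)) h
  have : IsOpen {y : E | innerSL ℝ ((-v : sphere (0 : E) 1) : E) y ≠ (1 : ℝ)} :=
    isOpen_ne_fun (innerSL ℝ _).continuous continuous_const
  rw [Set.preimage_univ, Set.inter_univ]
  refine this.mem_nhds ?_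
  have hv : ‖(v : E)‖ = 1 := by simp
  have h3 : inner ℝ ((-v : sphere (0 : E) 1) : E) (v : E) = -1 := by
    rw [coe_neg_sphere, inner_neg_left, real_inner_self_eq_norm_sq, hv]; norm_num
  change inner ℝ ((-v : sphere (0 : E) 1) : E) (v : E) ≠ 1
  rw [h3]; norm_num

end Sphere

/-! ### Descent of smoothness along submersions -/

section Submersion

open Set Manifold Filter Topology

variable {E E' E'' F H H' H'' : Type*} [NormedAddCommGroup E] [NormedSpace ℝ E]
  [NormedAddCommGroup E'] [NormedSpace ℝ E'] [NormedAddCommGroup E''] [NormedSpace ℝ E'']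
  [NormedAddCommGroup F] [NormedSpace ℝ F]
  [TopologicalSpace H] [TopologicalSpace H'] [TopologicalSpace H'']
  {I : ModelWithCorners ℝ E H} {I' : ModelWithCorners ℝ E' H'} {I'' : ModelWithCorners ℝ E'' H''}
  {M N X : Type*} [TopologicalSpace M] [ChartedSpace H M] [TopologicalSpace N] [ChartedSpace H' N]
  [TopologicalSpace X] [ChartedSpace H'' X] {k : WithTop ℕ∞}

/-- If `f` is a submersion at `x` and `g ∘ f` is `C^k` at `x`, then `g` is `C^k` at `f x`. -/
theorem contMDiffAt_of_comp_submersion [I.Boundaryless] [I'.Boundaryless] {f : M → N} {g : N → X}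
    {x : M} (hf : IsSubmersionAtOfComplement F I I' k f x)
    (hg : ContMDiffAt I I'' k (g ∘ f) x) : ContMDiffAt I' I'' k g (f x) := by
  set φ := hf.domChart
  set ψ := hf.codChart
  have hφ := hf.domChart_mem_maximalAtlas
  have hψ := hf.codChart_mem_maximalAtlas
  have hx : x ∈ φ.source := hf.mem_domChart_source
  have hfx : f x ∈ ψ.source := hf.mem_codChart_source
  have heq := hf.writtenInCharts
  set e := hf.equiv
  have hxt : φ.extend I x ∈ (φ.extend I).target :=
    (φ.extend I).map_source (by rwa [φ.extend_source])
  have hsx : (φ.extend I).symm (φ.extend I x) = x := φ.extend_left_inv hx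
  have ht : IsOpen (φ.extend I).target := φ.isOpen_extend_target
  have hfst : ψ.extend I' (f x) = (e (φ.extend I x)).1 := by
    have h := heq hxt
    change ψ.extend I' (f ((φ.extend I).symm (φ.extend I x))) = _ at h
    rwa [hsx] at h
  -- In charts, a local section of `f` through `x`: the base coordinate varies and the fibre
  -- coordinate stays that of `x`.
  let s : N → E := fun q => e.symm (ψ.extend I' q, (e (φ.extend I x)).2)
  have hs0 : s (f x) = φ.extend I x := by
    simp only [s, hfst]
    exact e.symm_apply_apply _
  have hs : ContMDiffAt I' 𝓘(ℝ, E) k s (f x) := by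
    have h1 : ContMDiffAt I' 𝓘(ℝ, E') k (ψ.extend I') (f x) :=
      ψ.contMDiffAt_extend hψ hfx
    have h2 : ContDiff ℝ k (fun u : E' => e.symm (u, (e (φ.extend I x)).2)) := by fun_prop
    exact h2.contMDiff.contMDiffAt.comp (f x) h1
  have h3 : ContMDiffAt 𝓘(ℝ, E) I k (φ.extend I).symm (s (f x)) := by
    rw [hs0]
    refine (contMDiffOn_extend_symm hφ).contMDiffAt ?_
    have := ht.mem_nhds hxt
    rwa [φ.extend_target_eq_image_source, φ.extend_coe, image_comp, φ.image_source_eq_target] at this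
  have h4 : ContMDiffAt I' I k ((φ.extend I).symm ∘ s) (f x) := h3.comp (f x) hs
  have h5 : ((φ.extend I).symm ∘ s) (f x) = x := by
    simp only [Function.comp_apply, hs0, hsx]
  have h6 : ContMDiffAt I' I'' k ((g ∘ f) ∘ ((φ.extend I).symm ∘ s)) (f x) :=
    ContMDiffAt.comp (f x) (by rwa [h5]) h4
  -- Near `f x` the lift of `s` to `M` is a right inverse of `f`, so composing `g ∘ f` with it
  -- returns `g`.
  refine h6.congr_of_eventuallyEq ?_
  have hev : ∀ᶠ q in 𝓝 (f x), s q ∈ (φ.extend I).target :=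
    hs.continuousAt (ht.mem_nhds (by rwa [hs0]))
  filter_upwards [hev, ψ.open_source.mem_nhds hfx, h4.continuousAt.preimage_mem_nhds
    (by rw [h5]; exact φ.open_source.mem_nhds hx)] with q hq hqs hq2
  have h7 := heq hq
  simp only [Function.comp_apply, s, ContinuousLinearEquiv.apply_symm_apply] at h7
  have h8 : f ((φ.extend I).symm (s q)) ∈ ψ.source :=
    hf.source_subset_preimage_source hq2
  have h9 := ψ.injOn (x₁ := f ((φ.extend I).symm (s q))) h8 hqs
    (I'.injective h7)
  simp only [Function.comp_apply, h9]

end Submersion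

/-! ### Comparing maximal atlases -/

section MaximalAtlas

open Set

variable {E H M : Type*} [NormedAddCommGroup E] [NormedSpace ℝ E] [TopologicalSpace H]
  {I : ModelWithCorners ℝ E H} [TopologicalSpace M] {k : WithTop ℕ∞}

/-- A chart that is obtained from a chart of the source by a diffeomorphism is a chart of the
target. -/
theorem mem_maximalAtlas_of_contMDiff {N : Type*} [ChartedSpace H M] [TopologicalSpace N]
    [ChartedSpace H N] [IsManifold I k N] {f : M → N} {g : N → M} (hf : ContMDiff I I k f)
    (hg : ContMDiff I I k g) {e : OpenPartialHomeomorph M H} {e' : OpenPartialHomeomorph N H}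
    (he : e ∈ IsManifold.maximalAtlas I k M) (hs : MapsTo g e'.source e.source)
    (heq : EqOn e' (e ∘ g) e'.source) (ht : e'.target ⊆ e.target)
    (hsymm : EqOn e'.symm (f ∘ e.symm) e'.target) : e' ∈ IsManifold.maximalAtlas I k N := by
  refine e'.mem_maximalAtlas_of_contMDiffOn ?_ ?_
  · exact ((contMDiffOn_of_mem_maximalAtlas he).comp hg.contMDiffOn hs).congr heq
  · exact (hf.comp_contMDiffOn ((contMDiffOn_symm_of_mem_maximalAtlas he).mono ht)).congr hsymm

/-- If the identity is `C^k` from the structure `c` to the structure `c'` and back, then every chart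
of `c` is a chart of `c'`. -/
theorem maximalAtlas_subset_of_contMDiff_id (c c' : ChartedSpace H M)
    (hc' : @IsManifold ℝ _ E _ _ H _ I k M _ c')
    (h : @ContMDiff ℝ _ E _ _ H _ I M _ c E _ _ H _ I M _ c' k id)
    (h' : @ContMDiff ℝ _ E _ _ H _ I M _ c' E _ _ H _ I M _ c k id) :
    @IsManifold.maximalAtlas ℝ _ E _ _ H _ I k M _ c ⊆
      @IsManifold.maximalAtlas ℝ _ E _ _ H _ I k M _ c' := fun e he =>
  @mem_maximalAtlas_of_contMDiff E H M _ _ _ I _ k M c _ c' hc' id id h h' e e he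
    (fun _ hx => hx) (fun _ _ => rfl) subset_rfl fun _ _ => rfl

end MaximalAtlas

/-! ### Calculus of matrix-valued maps, entry by entry -/

section EntrySmooth

variable {E H X : Type*} [NormedAddCommGroup E] [NormedSpace ℝ E] [TopologicalSpace H]
  {I : ModelWithCorners ℝ E H} [TopologicalSpace X] [ChartedSpace H X] {x : X}
  {a b c : Type*}

variable (I) in
/-- All entries of the matrix-valued map `A` are smooth at `x`. -/
def EntrySmoothAt (A : X → Matrix c b ℝ) (x : X) : Prop :=
  ∀ i j, ContMDiffAt I 𝓘(ℝ, ℝ) ∞ (fun y => A y i j) x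

theorem entrySmoothAt_const (A : Matrix c b ℝ) : EntrySmoothAt I (fun _ : X => A) x :=
  fun _ _ => contMDiffAt_const

theorem EntrySmoothAt.mul [Fintype b] {A : X → Matrix c b ℝ} {B : X → Matrix b a ℝ}
    (hA : EntrySmoothAt I A x) (hB : EntrySmoothAt I B x) :
    EntrySmoothAt I (fun y => A y * B y) x := fun i j => by
  simp only [Matrix.mul_apply]
  exact ContMDiffAt.sum fun k _ => (hA i k).mul (hB k j)

theorem EntrySmoothAt.add {A B : X → Matrix c b ℝ}
    (hA : EntrySmoothAt I A x) (hB : EntrySmoothAt I B x) :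
    EntrySmoothAt I (fun y => A y + B y) x := fun i j => (hA i j).add (hB i j)

theorem EntrySmoothAt.sub {A B : X → Matrix c b ℝ}
    (hA : EntrySmoothAt I A x) (hB : EntrySmoothAt I B x) :
    EntrySmoothAt I (fun y => A y - B y) x := fun i j => (hA i j).sub (hB i j)

theorem EntrySmoothAt.transpose {A : X → Matrix c b ℝ} (hA : EntrySmoothAt I A x) :
    EntrySmoothAt I (fun y => (A y).transpose) x := fun i j => hA j i

theorem EntrySmoothAt.congr {A B : X → Matrix c b ℝ} (hA : EntrySmoothAt I A x)
    (h : ∀ᶠ y in nhds x, B y = A y) : EntrySmoothAt I B x := fun i j =>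
  (hA i j).congr_of_eventuallyEq (h.mono fun y hy => by simp only [hy])

theorem EntrySmoothAt.det [Fintype a] [DecidableEq a] {A : X → Matrix a a ℝ} (hA : EntrySmoothAt I A x) :
    ContMDiffAt I 𝓘(ℝ, ℝ) ∞ (fun y => (A y).det) x := by
  simp only [Matrix.det_apply']
  exact ContMDiffAt.sum fun σ _ => contMDiffAt_const.mul (ContMDiffAt.prod fun i _ => hA _ _)

/-- Cramer's rule: each entry is a determinant of smooth entries divided by a determinant that is
nonzero at `x`. -/
theorem EntrySmoothAt.inv [Fintype a] [DecidableEq a] {A : X → Matrix a a ℝ} (hA : EntrySmoothAt I A x)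
    (hx : IsUnit (A x).det) : EntrySmoothAt I (fun y => (A y)⁻¹) x := fun i j => by
  simp only [Matrix.inv_def, Ring.inverse_eq_inv', Matrix.smul_apply, smul_eq_mul,
    Matrix.adjugate_apply]
  refine ContMDiffAt.mul ?_ (EntrySmoothAt.det ?_)
  · exact (contDiffAt_inv ℝ hx.ne_zero).contMDiffAt.comp x hA.det
  · intro k l
    simp only [Matrix.updateRow_apply]
    split_ifs
    · exact contMDiffAt_const
    · exact hA k l

end EntrySmooth

/-! ### Uniqueness and smoothness of the Cholesky factor -/

section Cholesky

variable {d : ℕ} {X L L' : Matrix (Fin d) (Fin d) ℝ}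

/-- Triangularity cuts the product off at index `j`. Solving for the last term expresses column `j`
of `L` through `X` and the earlier columns; both uniqueness and smoothness are inductions on this
recursion. -/
theorem IsCholeskyFactor.apply_eq_sum (h : IsCholeskyFactor X L) (i j : Fin d) :
    X i j = ∑ k ∈ Finset.Iio j, L i k * L j k + L i j * L j j := by
  rw [← h.mul_transpose, Matrix.mul_apply]
  simp only [Matrix.transpose_apply]
  rw [← Finset.sum_subset (Finset.subset_univ (Finset.Iic j)), ← Finset.Iio_insert,
    Finset.sum_insert (by simp), add_comm]
  intro k _ hk
  rw [h.lower j k (by simpa using hk), mul_zero]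

theorem IsCholeskyFactor.diag_eq (h : IsCholeskyFactor X L) (j : Fin d) :
    L j j = √(X j j - ∑ k ∈ Finset.Iio j, L j k * L j k) := by
  rw [h.apply_eq_sum j j, add_sub_cancel_left, Real.sqrt_mul_self (h.pos j).le]

theorem IsCholeskyFactor.entry_eq (h : IsCholeskyFactor X L) (i j : Fin d) :
    L i j = (X i j - ∑ k ∈ Finset.Iio j, L i k * L j k) * (L j j)⁻¹ := by
  rw [h.apply_eq_sum i j, add_sub_cancel_left, mul_inv_cancel_right₀ (h.pos j).ne']

/-- The Cholesky factor is unique. -/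
theorem IsCholeskyFactor.unique (h : IsCholeskyFactor X L) (h' : IsCholeskyFactor X L') :
    L = L' := by
  suffices ∀ j i, L i j = L' i j from Matrix.ext fun i j => this j i
  intro j
  induction j using WellFoundedLT.induction with
  | ind j ih =>
    have hs : ∀ i, ∑ k ∈ Finset.Iio j, L i k * L j k = ∑ k ∈ Finset.Iio j, L' i k * L' j k :=
      fun i => Finset.sum_congr rfl fun k hk => by
        rw [ih k (Finset.mem_Iio.1 hk), ih k (Finset.mem_Iio.1 hk)]
    intro i
    rw [h.entry_eq, h'.entry_eq, h.diag_eq, h'.diag_eq, hs, hs]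

theorem cholesky_eq (h : IsCholeskyFactor X L) : cholesky X = L := by
  have h' : ∃ L, IsCholeskyFactor X L := ⟨L, h⟩
  rw [cholesky, dif_pos h']
  exact h'.choose_spec.unique h

variable {E H M : Type*} [NormedAddCommGroup E] [NormedSpace ℝ E] [TopologicalSpace H]
  {I : ModelWithCorners ℝ E H} [TopologicalSpace M] [ChartedSpace H M] {x : M}

/-- The Cholesky factor depends smoothly on a family of invertible matrices. -/
theorem EntrySmoothAt.cholesky {A : M → Matrix (Fin d) (Fin d) ℝ} (hA : EntrySmoothAt I A x)
    (hx : IsUnit (A x).det) :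
    EntrySmoothAt I (fun y => cholesky (A y * (A y).transpose)) x := by
  set X : M → Matrix (Fin d) (Fin d) ℝ := fun y => A y * (A y).transpose
  set L : M → Matrix (Fin d) (Fin d) ℝ := fun y => LowRankCorrelation.cholesky (X y)
  have hX : EntrySmoothAt I X x := hA.mul hA.transpose
  have hL : ∀ᶠ y in nhds x, IsCholeskyFactor (X y) (L y) := by
    have h := hA.det.continuousAt.eventually_ne hx.ne_zero
    exact h.mono fun y hy => isCholeskyFactor_cholesky _ (isUnit_iff_ne_zero.2 hy)
  have hLx := hL.self_of_nhds
  suffices ∀ j i, ContMDiffAt I 𝓘(ℝ, ℝ) ∞ (fun y => L y i j) x from fun i j => this j i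
  intro j
  induction j using WellFoundedLT.induction with
  | ind j ih =>
    have hs : ∀ i, ContMDiffAt I 𝓘(ℝ, ℝ) ∞
        (fun y => X y i j - ∑ k ∈ Finset.Iio j, L y i k * L y j k) x := fun i =>
      (hX i j).sub (ContMDiffAt.sum fun k hk =>
        (ih k (Finset.mem_Iio.1 hk) i).mul (ih k (Finset.mem_Iio.1 hk) j))
    have hd : ContMDiffAt I 𝓘(ℝ, ℝ) ∞ (fun y => L y j j) x := by
      refine ContMDiffAt.congr_of_eventuallyEq (f := fun y =>
        √(X y j j - ∑ k ∈ Finset.Iio j, L y j k * L y j k)) ?_ (hL.mono fun y hy => hy.diag_eq j)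
      -- The radicand at `x` is the square of the positive diagonal entry, so the root is taken away
      -- from its singularity.
      refine (Real.contDiffAt_sqrt ?_).contMDiffAt.comp x (hs j)
      rw [hLx.apply_eq_sum j j, add_sub_cancel_left]
      exact (mul_pos (hLx.pos j) (hLx.pos j)).ne'
    intro i
    refine ContMDiffAt.congr_of_eventuallyEq ((hs i).mul
      ((contDiffAt_inv ℝ (hLx.pos j).ne').contMDiffAt.comp x hd))
      (hL.mono fun y hy => hy.entry_eq i j)

end Cholesky

/-! ### The Cayley transform as a chart of the orthogonal group -/

section Cayley

variable {ι : Type*} [Fintype ι] [DecidableEq ι] {A Q : Matrix ι ι ℝ}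

/-- The Cayley transform. -/
def cayley (A : Matrix ι ι ℝ) : Matrix ι ι ℝ := (1 - A) * (1 + A)⁻¹

/-- A kernel vector satisfies `v = -A v`, while skewness gives `v ⬝ᵥ A v = 0`; hence `v ⬝ᵥ v = 0`.
-/
theorem isUnit_det_one_add_of_skew (h : A.transpose = -A) : IsUnit (1 + A).det := by
  rw [← Matrix.isUnit_iff_isUnit_det, ← Matrix.mulVec_injective_iff_isUnit]
  refine (injective_iff_map_eq_zero (Matrix.mulVecLin (1 + A))).2 fun v hv => ?_
  have h1 : v = -(A.mulVec v) := by
    have : v + A.mulVec v = 0 := by simpa [Matrix.add_mulVec] using hv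
    exact eq_neg_of_add_eq_zero_left this
  have h2 : v ⬝ᵥ A.mulVec v = 0 := by
    have : v ⬝ᵥ A.mulVec v = -(v ⬝ᵥ A.mulVec v) := by
      conv_lhs => rw [Matrix.dotProduct_mulVec, ← Matrix.mulVec_transpose, h, Matrix.neg_mulVec,
        neg_dotProduct, dotProduct_comm]
    linarith
  have h3 : v ⬝ᵥ v = 0 := by
    calc v ⬝ᵥ v = v ⬝ᵥ (-(A.mulVec v)) := congrArg (v ⬝ᵥ ·) h1
      _ = 0 := by rw [dotProduct_neg, h2, neg_zero]
  exact dotProduct_self_eq_zero.1 h3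

theorem one_add_cayley (h : IsUnit (1 + A).det) : 1 + cayley A = (2 : ℝ) • (1 + A)⁻¹ := by
  have h1 : (1 : Matrix ι ι ℝ) = (1 + A) * (1 + A)⁻¹ := (Matrix.mul_nonsing_inv _ h).symm
  rw [cayley]
  nth_rewrite 1 [h1]
  rw [← add_mul, two_smul, add_add_sub_cancel, add_mul, one_mul]

theorem isUnit_det_one_add_cayley (h : IsUnit (1 + A).det) : IsUnit (1 + cayley A).det := by
  rw [one_add_cayley h, Matrix.det_smul]
  exact ((isUnit_iff_ne_zero.2 two_ne_zero).pow _).mul (Matrix.isUnit_nonsing_inv_det _ h)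

/-- The Cayley transform is an involution. -/
theorem cayley_cayley (h : IsUnit (1 + A).det) : cayley (cayley A) = A := by
  have h1 : (1 : Matrix ι ι ℝ) = (1 + A) * (1 + A)⁻¹ := (Matrix.mul_nonsing_inv _ h).symm
  have h2 : 1 - cayley A = (2 : ℝ) • (A * (1 + A)⁻¹) := by
    rw [cayley]
    nth_rewrite 1 [h1]
    rw [← sub_mul, two_smul, ← add_mul]
    congr 1
    abel
  have h3 := isUnit_det_one_add_cayley h
  have h4 : A * (1 + cayley A) = 1 - cayley A := by
    rw [h2, one_add_cayley h, Matrix.mul_smul]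
  conv_lhs => rw [cayley, ← h4, Matrix.mul_nonsing_inv_cancel_right _ _ h3]

/-- Transposition exchanges `1 + A` and `1 - A`, whose inverses commute, so everything cancels in
the product with the transpose. -/
theorem cayley_mem_orthogonalGroup (h : A.transpose = -A) :
    cayley A ∈ Matrix.orthogonalGroup ι ℝ := by
  have hu := isUnit_det_one_add_of_skew h
  have hu' : IsUnit (1 - A).det := by
    rw [← Matrix.det_transpose, Matrix.transpose_sub, h, Matrix.transpose_one, sub_neg_eq_add]
    exact hu
  rw [Matrix.mem_orthogonalGroup_iff]
  change cayley A * (cayley A).transpose = 1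
  have hc : (1 + A)⁻¹ * (1 - A)⁻¹ = (1 - A)⁻¹ * (1 + A)⁻¹ := by
    rw [← Matrix.mul_inv_rev, ← Matrix.mul_inv_rev]
    congr 1
    noncomm_ring
  rw [cayley, Matrix.transpose_mul, Matrix.transpose_nonsing_inv, Matrix.transpose_add,
    Matrix.transpose_sub, h, Matrix.transpose_one, sub_neg_eq_add, ← sub_eq_add_neg,
    Matrix.mul_assoc, ← Matrix.mul_assoc _ _ (1 + A), hc, Matrix.mul_assoc,
    Matrix.nonsing_inv_mul _ hu, Matrix.mul_one, Matrix.mul_nonsing_inv _ hu']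

/-- Orthogonality gives `(1 + Qᵀ)(1 - Q) = -(1 - Qᵀ)(1 + Q)`; moving the two inverses across yields
the claim. -/
theorem transpose_cayley (hQ : Q ∈ Matrix.orthogonalGroup ι ℝ) (h : IsUnit (1 + Q).det) :
    (cayley Q).transpose = -cayley Q := by
  have h1 : Q.transpose * Q = 1 := (Matrix.mem_orthogonalGroup_iff' ι ℝ).1 hQ
  have hu : IsUnit (1 + Q.transpose).det := by
    rw [← Matrix.det_transpose, Matrix.transpose_add, Matrix.transpose_transpose,
      Matrix.transpose_one]
    exact h
  rw [cayley, Matrix.transpose_mul, Matrix.transpose_nonsing_inv, Matrix.transpose_add,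
    Matrix.transpose_sub, Matrix.transpose_one]
  have h2 : (1 + Q.transpose) * (1 - Q) = -((1 - Q.transpose) * (1 + Q)) := by
    have : (1 + Q.transpose) * (1 - Q) = 1 - Q + Q.transpose - Q.transpose * Q := by noncomm_ring
    rw [this]
    have : (1 - Q.transpose) * (1 + Q) = 1 + Q - Q.transpose - Q.transpose * Q := by noncomm_ring
    rw [this, h1]
    abel
  have h3 : (1 - Q.transpose) = -((1 + Q.transpose) * (1 - Q) * (1 + Q)⁻¹) := by
    rw [h2, neg_mul, neg_neg, Matrix.mul_nonsing_inv_cancel_right _ _ h]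
  conv_lhs => rw [h3]
  rw [Matrix.mul_neg, Matrix.mul_assoc, Matrix.nonsing_inv_mul_cancel_left _ _ hu]

theorem cayley_zero : cayley (0 : Matrix ι ι ℝ) = 1 := by simp [cayley]

theorem isUnit_det_one_add_one : IsUnit (1 + 1 : Matrix ι ι ℝ).det := by
  have h := isUnit_det_one_add_cayley (A := (0 : Matrix ι ι ℝ)) (by simp)
  rwa [cayley_zero] at h

theorem cayley_one : cayley (1 : Matrix ι ι ℝ) = 0 := by simp [cayley]

variable {E H X : Type*} [NormedAddCommGroup E] [NormedSpace ℝ E] [TopologicalSpace H]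
  {I : ModelWithCorners ℝ E H} [TopologicalSpace X] [ChartedSpace H X] {x : X}

theorem EntrySmoothAt.cayley {A : X → Matrix ι ι ℝ} (hA : EntrySmoothAt I A x)
    (hx : IsUnit (1 + A x).det) : EntrySmoothAt I (fun y => cayley (A y)) x :=
  ((entrySmoothAt_const 1).sub hA).mul (((entrySmoothAt_const 1).add hA).inv hx)

end Cayley

/-! ### Coordinates on skew-symmetric matrices -/

section Skew

variable {d : ℕ}

/-- The index set of the entries above the diagonal. -/
abbrev UpperPairs (d : ℕ) : Type := {p : Fin d × Fin d // p.1 < p.2}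

/-- The skew-symmetric matrix with given entries above the diagonal. -/
def skew (u : UpperPairs d → ℝ) : Matrix (Fin d) (Fin d) ℝ := Matrix.of fun i j =>
  if h : i < j then u ⟨(i, j), h⟩ else if h : j < i then -u ⟨(j, i), h⟩ else 0

/-- The entries of a matrix above the diagonal. -/
def upper (A : Matrix (Fin d) (Fin d) ℝ) : UpperPairs d → ℝ := fun p => A p.1.1 p.1.2

theorem transpose_skew (u : UpperPairs d → ℝ) : (skew u).transpose = -skew u := by
  ext i j
  rcases lt_trichotomy i j with h | h | h <;> simp [skew, h, h.not_gt]

theorem upper_skew (u : UpperPairs d → ℝ) : upper (skew u) = u := by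
  funext ⟨p, hp⟩
  simp [upper, skew, hp]

theorem skew_upper {A : Matrix (Fin d) (Fin d) ℝ} (h : A.transpose = -A) : skew (upper A) = A := by
  ext i j
  have hij : A j i = -A i j := congrFun (congrFun h i) j
  rcases lt_trichotomy i j with h' | h' | h'
  · simp [skew, upper, h']
  · subst h'
    simp only [skew, Matrix.of_apply, lt_irrefl, dite_false]
    linarith
  · simp [skew, upper, h', h'.not_gt, hij]

end Skew

/-! ### Pivots, free entries and the slice of normal forms -/

section RowData

variable {n d : ℕ} {J : Lex (Fin d → Fin n)}

/-- A choice of a pivot column and of the sign of the pivot entry for every row, which are the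
diagonal and the positive sign for the rows with indices in `J`. -/
structure RowData (J : Lex (Fin d → Fin n)) where
  strictMono : StrictMono (ofLex J)
  piv : Fin n → Fin d
  sgn : Fin n → ℝ
  sgn_mul_self : ∀ i, sgn i * sgn i = 1
  piv_apply : ∀ a, piv (ofLex J a) = a
  sgn_apply : ∀ a, sgn (ofLex J a) = 1

/-- The entry `(i, j)` is not a pivot and does not lie above the diagonal of the rows with indices
in `J`. -/
def RowData.IsFree (D : RowData J) (p : Fin n × Fin d) : Prop :=
  p.2 ≠ D.piv p.1 ∧ ∀ a, p.1 = ofLex J a → p.2 < a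

instance (D : RowData J) : DecidablePred D.IsFree := fun _ => inferInstanceAs (Decidable (_ ∧ _))

/-- The positions of the free entries. -/
abbrev RowData.Free (D : RowData J) : Type := {p : Fin n × Fin d // D.IsFree p}

theorem card_upperPairs (d : ℕ) : Fintype.card (UpperPairs d) = d * (d - 1) / 2 := by
  rw [← Finset.sum_range_id, Finset.sum_range, Fintype.card_subtype, Finset.card_filter,
    ← Finset.univ_product_univ, Finset.sum_product_right]
  refine Finset.sum_congr rfl fun b _ => ?_
  rw [← Finset.card_filter]
  have : (Finset.univ.filter fun x : Fin d => x < b) = Finset.Iio b := by ext; simp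
  rw [this, Fin.card_Iio]

/-- Each row has `d - 1` non-pivot positions. Those that are not free lie above the diagonal of the
`J`-rows, and `(a, b) ↦ (J a, b)` matches them with the pairs `a < b`. -/
theorem RowData.card_free_add (D : RowData J) :
    Fintype.card D.Free + Fintype.card (UpperPairs d) = n * (d - 1) := by
  have hpiv : Fintype.card {p : Fin n × Fin d // p.2 ≠ D.piv p.1} = n * (d - 1) := by
    rw [Fintype.card_subtype, Finset.card_filter, ← Finset.univ_product_univ, Finset.sum_product]
    have h : ∀ i : Fin n, (∑ j : Fin d, if j ≠ D.piv i then 1 else 0) = d - 1 := fun i => by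
      rw [← Finset.card_filter, Finset.filter_ne', Finset.card_erase_of_mem (Finset.mem_univ _),
        Finset.card_univ, Fintype.card_fin]
    simp only [h, Finset.sum_const, Finset.card_univ, Fintype.card_fin, smul_eq_mul]
  rw [← hpiv, ← Fintype.card_sum]
  let f : D.Free ⊕ UpperPairs d → {p : Fin n × Fin d // p.2 ≠ D.piv p.1} := Sum.elim
    (fun p => ⟨p.1, p.2.1⟩)
    (fun p => ⟨(ofLex J p.1.1, p.1.2), by
      change p.1.2 ≠ D.piv (ofLex J p.1.1)
      rw [D.piv_apply]
      exact p.2.ne'⟩)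
  refine Fintype.card_of_bijective (f := f) ⟨?_, ?_⟩
  · rintro (⟨p, hp⟩ | ⟨⟨a, b⟩, hab⟩) (⟨q, hq⟩ | ⟨⟨a', b'⟩, hab'⟩) h
    · simp only [f, Sum.elim_inl, Subtype.mk.injEq] at h
      simp [h]
    · simp only [f, Sum.elim_inl, Sum.elim_inr, Subtype.mk.injEq] at h
      subst h
      exact absurd (hp.2 a' rfl) hab'.not_gt
    · simp only [f, Sum.elim_inl, Sum.elim_inr, Subtype.mk.injEq] at h
      subst h
      exact absurd (hq.2 a rfl) hab.not_gt
    · simp only [f, Sum.elim_inr, Subtype.mk.injEq, Prod.mk.injEq] at h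
      simp [D.strictMono.injective h.1, h.2]
  · rintro ⟨⟨i, j⟩, hp⟩
    by_cases h : D.IsFree (i, j)
    · exact ⟨Sum.inl ⟨_, h⟩, rfl⟩
    · simp only [RowData.IsFree, not_and, not_forall] at h
      obtain ⟨a, rfl, ha⟩ := h hp
      have hne : j ≠ a := fun h => hp (h.trans (D.piv_apply a).symm)
      exact ⟨Sum.inr ⟨(a, j), lt_of_le_of_ne (not_lt.1 ha) hne.symm⟩, rfl⟩

/-- The additive count shows that the truncated subtraction in `dimM` loses nothing once a `RowData`
exists. -/
theorem RowData.card_free (D : RowData J) : Fintype.card D.Free = dimM n d := by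
  have h := D.card_free_add
  rw [card_upperPairs] at h
  rw [dimM]
  omega

/-- The free entries of a matrix. -/
def RowData.free (D : RowData J) (A : Matrix (Fin n) (Fin d) ℝ) : D.Free → ℝ :=
  fun p => A p.1.1 p.1.2

/-- The matrix with given free entries and zeros elsewhere. -/
def RowData.fill (D : RowData J) (x : D.Free → ℝ) : Matrix (Fin n) (Fin d) ℝ :=
  Matrix.of fun i j => if h : D.IsFree (i, j) then x ⟨(i, j), h⟩ else 0

/-- The square of the pivot entry of a unit row with given free entries. -/
def RowData.gap (D : RowData J) (x : D.Free → ℝ) (i : Fin n) : ℝ :=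
  1 - ∑ j, D.fill x i j * D.fill x i j

/-- The vectors that are the free entries of a matrix with unit rows and nonzero pivots. -/
def RowData.dom (D : RowData J) : Set (D.Free → ℝ) := {x | ∀ i, 0 < D.gap x i}

/-- The matrix with unit rows and given free entries. -/
def RowData.slice (D : RowData J) (x : D.Free → ℝ) : Matrix (Fin n) (Fin d) ℝ :=
  Matrix.of fun i j => if j = D.piv i then D.sgn i * √(D.gap x i) else D.fill x i j

variable (D : RowData J)

theorem RowData.fill_piv (x : D.Free → ℝ) (i : Fin n) : D.fill x i (D.piv i) = 0 := by
  simp [RowData.fill, RowData.IsFree]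

theorem RowData.slice_piv (x : D.Free → ℝ) (i : Fin n) :
    D.slice x i (D.piv i) = D.sgn i * √(D.gap x i) := by
  simp [RowData.slice]

theorem RowData.slice_of_ne (x : D.Free → ℝ) {i : Fin n} {j : Fin d} (h : j ≠ D.piv i) :
    D.slice x i j = D.fill x i j := by
  simp [RowData.slice, h]

theorem RowData.free_slice (x : D.Free → ℝ) : D.free (D.slice x) = x := by
  funext ⟨⟨i, j⟩, h⟩
  rw [RowData.free, D.slice_of_ne x h.1]
  simp [RowData.fill, h]

theorem RowData.slice_dot_self {x : D.Free → ℝ} (hx : x ∈ D.dom) (i : Fin n) :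
    (D.slice x * (D.slice x).transpose) i i = 1 := by
  rw [Matrix.mul_apply]
  simp only [Matrix.transpose_apply]
  have h1 : ∀ j ∈ Finset.univ.erase (D.piv i),
      D.slice x i j * D.slice x i j = D.fill x i j * D.fill x i j := fun j hj => by
    rw [D.slice_of_ne x (Finset.ne_of_mem_erase hj)]
  have h2 : ∑ j ∈ Finset.univ.erase (D.piv i), D.fill x i j * D.fill x i j =
      ∑ j, D.fill x i j * D.fill x i j := by
    rw [← Finset.add_sum_erase Finset.univ _ (Finset.mem_univ (D.piv i)), D.fill_piv]
    ring
  rw [← Finset.add_sum_erase Finset.univ _ (Finset.mem_univ (D.piv i)),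
    Finset.sum_congr rfl h1, h2, D.slice_piv]
  have h3 := Real.mul_self_sqrt (hx i).le
  have h4 := D.sgn_mul_self i
  calc _ = (D.sgn i * D.sgn i) * (√(D.gap x i) * √(D.gap x i)) +
        ∑ j, D.fill x i j * D.fill x i j := by ring
    _ = 1 := by rw [h3, h4, RowData.gap]; ring

/-- The rows of `A` with indices in `J` form a lower triangular matrix with positive diagonal. -/
def IsNormal (J : Lex (Fin d → Fin n)) (A : Matrix (Fin n) (Fin d) ℝ) : Prop :=
  IsCholeskyFactor (A.submatrix (ofLex J) id * (A.submatrix (ofLex J) id).transpose)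
    (A.submatrix (ofLex J) id)

theorem IsNormal.isUnit_det {A : Matrix (Fin n) (Fin d) ℝ} (h : IsNormal J A) :
    IsUnit (A.submatrix (ofLex J) id).det := by
  rw [Matrix.det_of_isLowerTriangular _ fun i j hij => h.lower i j hij]
  exact isUnit_iff_ne_zero.2 (Finset.prod_ne_zero_iff.2 fun i _ => (h.pos i).ne')

theorem IsNormal.rank_eq {A : Matrix (Fin n) (Fin d) ℝ} (h : IsNormal J A) : A.rank = d := by
  refine le_antisymm A.rank_le_width ?_
  have h1 := Matrix.rank_submatrix_le A (ofLex J) (id : Fin d → Fin d)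
  have h2 := Matrix.rank_of_isUnit _ ((Matrix.isUnit_iff_isUnit_det _).2 h.isUnit_det)
  rw [Fintype.card_fin] at h2
  exact h2.symm.le.trans h1

theorem RowData.isNormal_slice {x : D.Free → ℝ} (hx : x ∈ D.dom) : IsNormal J (D.slice x) where
  lower i j hij := by
    rw [Matrix.submatrix_apply, id, D.slice_of_ne x (by rw [D.piv_apply]; exact hij.ne')]
    have : ¬ D.IsFree (ofLex J i, j) := fun h => absurd (h.2 i rfl) hij.not_gt
    simp only [RowData.fill, Matrix.of_apply, this, dite_false]
  pos i := by
    have h := D.slice_piv x (ofLex J i)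
    rw [D.piv_apply, D.sgn_apply, one_mul] at h
    rw [Matrix.submatrix_apply, id, h]
    exact Real.sqrt_pos.2 (hx _)
  mul_transpose := rfl

/-- A non-pivot entry that is not free lies above the `J`-diagonal, where a normal matrix vanishes,
in agreement with the default `0` of `fill`. -/
theorem RowData.fill_free {A : Matrix (Fin n) (Fin d) ℝ} (hA : IsNormal J A) {i : Fin n}
    {j : Fin d} (hj : j ≠ D.piv i) : D.fill (D.free A) i j = A i j := by
  by_cases h : D.IsFree (i, j)
  · simp [RowData.fill, RowData.free, h]
  · have h' := h
    simp only [RowData.IsFree, not_and, not_forall] at h'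
    obtain ⟨a, rfl, ha⟩ := h' hj
    rw [D.piv_apply] at hj
    simp only [RowData.fill, Matrix.of_apply, h, dite_false]
    exact (hA.lower a j (lt_of_le_of_ne (not_lt.1 ha) hj.symm)).symm

theorem RowData.gap_free {A : Matrix (Fin n) (Fin d) ℝ} (hA : IsNormal J A)
    (h1 : ∀ i, (A * A.transpose) i i = 1) (i : Fin n) :
    D.gap (D.free A) i = A i (D.piv i) * A i (D.piv i) := by
  have h := h1 i
  rw [Matrix.mul_apply] at h
  simp only [Matrix.transpose_apply] at h
  rw [← Finset.add_sum_erase Finset.univ _ (Finset.mem_univ (D.piv i))] at h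
  rw [RowData.gap, ← Finset.add_sum_erase Finset.univ _ (Finset.mem_univ (D.piv i)), D.fill_piv,
    Finset.sum_congr rfl fun j hj => by rw [D.fill_free hA (Finset.ne_of_mem_erase hj)]]
  linarith

theorem RowData.free_mem_dom {A : Matrix (Fin n) (Fin d) ℝ} (hA : IsNormal J A)
    (h1 : ∀ i, (A * A.transpose) i i = 1) (h2 : ∀ i, 0 < D.sgn i * A i (D.piv i)) :
    D.free A ∈ D.dom := fun i => by
  rw [D.gap_free hA h1]
  exact mul_self_pos.2 fun h => by simpa [h] using h2 i

/-- Unit length determines the square of each pivot, and the sign condition `h2` selects the right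
root. -/
theorem RowData.slice_free {A : Matrix (Fin n) (Fin d) ℝ} (hA : IsNormal J A)
    (h1 : ∀ i, (A * A.transpose) i i = 1) (h2 : ∀ i, 0 < D.sgn i * A i (D.piv i)) :
    D.slice (D.free A) = A := by
  ext i j
  by_cases h : j = D.piv i
  · subst h
    rw [D.slice_piv, D.gap_free hA h1]
    have h3 : A i (D.piv i) * A i (D.piv i) =
        (D.sgn i * A i (D.piv i)) * (D.sgn i * A i (D.piv i)) := by
      have := D.sgn_mul_self i
      linear_combination (- A i (D.piv i) * A i (D.piv i)) * this
    rw [h3, Real.sqrt_mul_self (h2 i).le, ← mul_assoc, D.sgn_mul_self, one_mul]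
  · rw [D.slice_of_ne _ h, D.fill_free hA h]

theorem RowData.sgn_mul_slice_pos {x : D.Free → ℝ} (hx : x ∈ D.dom) (i : Fin n) :
    0 < D.sgn i * D.slice x i (D.piv i) := by
  rw [D.slice_piv, ← mul_assoc, D.sgn_mul_self, one_mul]
  exact Real.sqrt_pos.2 (hx i)

/-- The point of `T*_{n,d}` with given free entries. -/
def RowData.point (x : D.Free → ℝ) (hx : x ∈ D.dom) : TStar n d :=
  ⟨ofMat (D.slice x) (D.slice_dot_self hx), (D.isNormal_slice hx).rank_eq⟩

theorem RowData.continuous_gap (i : Fin n) : Continuous fun x => D.gap x i := by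
  refine continuous_const.sub (continuous_finsetSum _ fun j _ => ?_)
  have : Continuous fun x => D.fill x i j := by
    simp only [RowData.fill, Matrix.of_apply]
    split_ifs
    · exact continuous_apply _
    · exact continuous_const
  exact this.mul this

theorem RowData.isOpen_dom : IsOpen D.dom := by
  have : D.dom = ⋂ i, {x | 0 < D.gap x i} := by ext; simp [RowData.dom]
  rw [this]
  exact isOpen_iInter_of_finite fun i => isOpen_lt continuous_const (D.continuous_gap i)

variable {E H X : Type*} [NormedAddCommGroup E] [NormedSpace ℝ E] [TopologicalSpace H]
  {I : ModelWithCorners ℝ E H} [TopologicalSpace X] [ChartedSpace H X] {y : X}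

theorem RowData.entrySmoothAt_slice {x : X → D.Free → ℝ}
    (hx : ∀ p, ContMDiffAt I 𝓘(ℝ, ℝ) ∞ (fun z => x z p) y) (hy : x y ∈ D.dom) :
    EntrySmoothAt I (fun z => D.slice (x z)) y := by
  have hf : EntrySmoothAt I (fun z => D.fill (x z)) y := fun i j => by
    simp only [RowData.fill, Matrix.of_apply]
    split_ifs
    · exact hx _
    · exact contMDiffAt_const
  intro i j
  simp only [RowData.slice, Matrix.of_apply]
  split_ifs
  · refine contMDiffAt_const.mul ((Real.contDiffAt_sqrt (hy i).ne').contMDiffAt.comp y ?_)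
    exact contMDiffAt_const.sub (ContMDiffAt.sum fun j _ => (hf i j).mul (hf i j))
  · exact hf i j

end RowData

/-! ### The splitting of a point into normal form and rotation -/

section NormalForm

variable {n d : ℕ} {J : Lex (Fin d → Fin n)}

/-- The matrix `Z Q` of the normal form of `Z` relative to `J`. -/
def normalMat (J : Lex (Fin d → Fin n)) (Z : TStar n d) : Matrix (Fin n) (Fin d) ℝ :=
  mat Z.1 * rotation J Z

theorem mat_normalForm {Z : TStar n d} (h : J ∈ indexSets Z) :
    mat (normalForm J Z h).1 = normalMat J Z := rfl

theorem mat_act (Z : TStar n d) (Q : Matrix (Fin d) (Fin d) ℝ)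
    (hQ : Q ∈ Matrix.orthogonalGroup (Fin d) ℝ) : mat (act Z Q hQ).1 = mat Z.1 * Q := rfl

theorem isNormal_normalMat {Z : TStar n d} (h : J ∈ indexSets Z) : IsNormal J (normalMat J Z) := by
  have hc := isCholeskyFactor_cholesky _ ((mem_indexSets_iff J Z).1 h).2
  have h1 : (normalMat J Z).submatrix (ofLex J) id =
      cholesky (rows J Z * (rows J Z).transpose) := by
    rw [← rows_mul_rotation h]
    rfl
  rw [IsNormal, h1]
  exact ⟨hc.lower, hc.pos, rfl⟩

theorem normalMat_dot_self {Z : TStar n d} (h : J ∈ indexSets Z) (i : Fin n) :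
    (normalMat J Z * (normalMat J Z).transpose) i i = 1 :=
  row_dot_self (normalForm J Z h).1 i

variable {Z : TStar n d} {S : Matrix (Fin n) (Fin d) ℝ} {R : Matrix (Fin d) (Fin d) ℝ}

theorem isUnit_det_of_mem_orthogonalGroup (hR : R ∈ Matrix.orthogonalGroup (Fin d) ℝ) :
    IsUnit R.det := by
  rw [← Matrix.isUnit_iff_isUnit_det]
  exact .of_mul_eq_one _ ((Matrix.mem_orthogonalGroup_iff (Fin d) ℝ).1 hR)

theorem transpose_mem_orthogonalGroup (hR : R ∈ Matrix.orthogonalGroup (Fin d) ℝ) :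
    R.transpose ∈ Matrix.orthogonalGroup (Fin d) ℝ := Unitary.star_mem hR

theorem mem_indexSets_of_isNormal (hJ : StrictMono (ofLex J)) (hS : IsNormal J S)
    (hR : R ∈ Matrix.orthogonalGroup (Fin d) ℝ) (h : mat Z.1 = S * R.transpose) :
    J ∈ indexSets Z := by
  rw [mem_indexSets_iff]
  refine ⟨hJ, ?_⟩
  have : rows J Z = S.submatrix (ofLex J) id * R.transpose := by rw [rows, h]; rfl
  rw [this, Matrix.det_mul, Matrix.det_transpose]
  exact hS.isUnit_det.mul (isUnit_det_of_mem_orthogonalGroup hR)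

/-- The Gram matrix of the `J`-rows of `Z` does not see `R`, so by uniqueness its Cholesky factor is
the `J`-block of `S`. Thus the decomposition `Z = S Rᵀ` is unique. -/
theorem rotation_eq_of_isNormal (hS : IsNormal J S) (hR : R ∈ Matrix.orthogonalGroup (Fin d) ℝ)
    (h : mat Z.1 = S * R.transpose) : rotation J Z = R := by
  have h1 : rows J Z = S.submatrix (ofLex J) id * R.transpose := by rw [rows, h]; rfl
  have h2 : R.transpose * R = 1 := (Matrix.mem_orthogonalGroup_iff' (Fin d) ℝ).1 hR
  have h3 : R⁻¹ = R.transpose := Matrix.inv_eq_left_inv h2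
  have h4 : R.transpose⁻¹ = R := by
    rw [← h3, Matrix.nonsing_inv_nonsing_inv _ (isUnit_det_of_mem_orthogonalGroup hR)]
  rw [rotation, h1, Matrix.transpose_mul, Matrix.transpose_transpose, Matrix.mul_assoc,
    ← Matrix.mul_assoc R.transpose, h2, Matrix.one_mul, cholesky_eq hS, Matrix.mul_inv_rev, h4,
    Matrix.mul_assoc, Matrix.nonsing_inv_mul _ hS.isUnit_det, Matrix.mul_one]

theorem normalMat_eq_of_isNormal (hS : IsNormal J S) (hR : R ∈ Matrix.orthogonalGroup (Fin d) ℝ)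
    (h : mat Z.1 = S * R.transpose) : normalMat J Z = S := by
  have h2 : R.transpose * R = 1 := (Matrix.mem_orthogonalGroup_iff' (Fin d) ℝ).1 hR
  rw [normalMat, rotation_eq_of_isNormal hS hR h, h, Matrix.mul_assoc, h2, Matrix.mul_one]

theorem mat_eq_normalMat_mul (h : J ∈ indexSets Z) :
    mat Z.1 = normalMat J Z * (rotation J Z).transpose := by
  have h2 : rotation J Z * (rotation J Z).transpose = 1 :=
    (Matrix.mem_orthogonalGroup_iff (Fin d) ℝ).1 (rotation_mem h)
  rw [normalMat, Matrix.mul_assoc, h2, Matrix.mul_one]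

theorem proj_act (Z : TStar n d) (Q : Matrix (Fin d) (Fin d) ℝ)
    (hQ : Q ∈ Matrix.orthogonalGroup (Fin d) ℝ) : proj (act Z Q hQ) = proj Z :=
  (Quotient.sound (s := orbitSetoid n d) ⟨Q, hQ, rfl⟩).symm

theorem normalMat_eq_of_proj_eq {Z W : TStar n d} (h : J ∈ indexSets Z) (hp : proj Z = proj W) :
    J ∈ indexSets W ∧ normalMat J Z = normalMat J W := by
  have hr : orbitSetoid n d Z W := Quotient.exact hp
  have hW := mem_indexSets_of_rel J hr h
  refine ⟨hW, ?_⟩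
  rw [← mat_normalForm h, ← mat_normalForm hW, normalForm_eq_of_rel J h hW hr]

theorem isOpen_setOf_mem_indexSets (J : Lex (Fin d → Fin n)) :
    IsOpen {Z : TStar n d | J ∈ indexSets Z} := by
  simp only [mem_indexSets_iff, isUnit_iff_ne_zero]
  exact isOpen_const.and (isOpen_ne_fun (continuous_rows _).matrix_det continuous_const)

theorem isQuotientMap_proj : Topology.IsQuotientMap (proj : TStar n d → MStar n d) :=
  isQuotientMap_quot_mk

theorem proj_out (p : MStar n d) : proj (Quotient.out p) = p := Quotient.out_eq p

theorem mul_cayley_mem (hR : R ∈ Matrix.orthogonalGroup (Fin d) ℝ) (u : UpperPairs d → ℝ) :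
    R * cayley (skew u) ∈ Matrix.orthogonalGroup (Fin d) ℝ :=
  mul_mem hR (cayley_mem_orthogonalGroup (transpose_skew u))

variable (D : RowData J)

/-- The points of `T*_{n,d}` for which the pivots of the normal form are nonzero and have the
prescribed signs. -/
def RowData.domain : Set (TStar n d) :=
  {Z | J ∈ indexSets Z ∧ ∀ i, 0 < D.sgn i * normalMat J Z i (D.piv i)}

theorem RowData.mem_domain_of_proj_eq {Z W : TStar n d} (hZ : Z ∈ D.domain)
    (h : proj Z = proj W) : W ∈ D.domain := by
  obtain ⟨hW, heq⟩ := normalMat_eq_of_proj_eq hZ.1 h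
  exact ⟨hW, fun i => heq ▸ hZ.2 i⟩

open Classical in
/-- The point of `T*_{n,d}` with given free entries, with a default value. -/
def RowData.pointD (Z₀ : TStar n d) (x : D.Free → ℝ) : TStar n d :=
  -- The value `Z₀` only makes the map total, as required of the inverse of a partial homeomorphism.
  if hx : x ∈ D.dom then D.point x hx else Z₀

theorem RowData.mat_pointD (Z₀ : TStar n d) {x : D.Free → ℝ} (hx : x ∈ D.dom) :
    mat (D.pointD Z₀ x).1 = D.slice x := by
  rw [RowData.pointD, dif_pos hx]
  rfl

theorem RowData.mat_pointD_eq (Z₀ : TStar n d) {x : D.Free → ℝ} (hx : x ∈ D.dom) :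
    mat (D.pointD Z₀ x).1 = D.slice x * (1 : Matrix (Fin d) (Fin d) ℝ).transpose := by
  rw [D.mat_pointD Z₀ hx, Matrix.transpose_one, Matrix.mul_one]

theorem RowData.pointD_mem_domain (Z₀ : TStar n d) {x : D.Free → ℝ} (hx : x ∈ D.dom) :
    D.pointD Z₀ x ∈ D.domain := by
  refine ⟨mem_indexSets_of_isNormal D.strictMono (D.isNormal_slice hx) (one_mem _)
    (D.mat_pointD_eq Z₀ hx), fun i => ?_⟩
  rw [normalMat_eq_of_isNormal (D.isNormal_slice hx) (one_mem _) (D.mat_pointD_eq Z₀ hx)]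
  exact D.sgn_mul_slice_pos hx i

theorem RowData.slice_free_normalMat {Z : TStar n d} (hZ : Z ∈ D.domain) :
    D.slice (D.free (normalMat J Z)) = normalMat J Z := by
  rw [D.slice_free (isNormal_normalMat hZ.1) (normalMat_dot_self hZ.1) hZ.2]

theorem RowData.pointD_free (Z₀ : TStar n d) {Z : TStar n d} (hZ : Z ∈ D.domain) :
    D.free (normalMat J Z) ∈ D.dom ∧
      D.pointD Z₀ (D.free (normalMat J Z)) = normalForm J Z hZ.1 := by
  have h1 := D.free_mem_dom (isNormal_normalMat hZ.1) (normalMat_dot_self hZ.1) hZ.2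
  refine ⟨h1, Subtype.ext (mat_injective ?_)⟩
  rw [D.mat_pointD Z₀ h1, mat_normalForm, D.slice_free_normalMat hZ]

variable (hR : R ∈ Matrix.orthogonalGroup (Fin d) ℝ)

/-- The part of the domain where the Cayley transform of the rotation relative to `R` exists. -/
def RowData.prodDomain (R : Matrix (Fin d) (Fin d) ℝ) : Set (TStar n d) :=
  {Z | Z ∈ D.domain ∧ IsUnit (1 + R.transpose * rotation J Z).det}

/-- The inverse of the chart `prodChart`. -/
def RowData.prodPoint (Z₀ : TStar n d) (q : (D.Free → ℝ) × (UpperPairs d → ℝ)) : TStar n d :=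
  act (D.pointD Z₀ q.1) (R * cayley (skew q.2)).transpose
    (transpose_mem_orthogonalGroup (mul_cayley_mem hR q.2))

theorem RowData.mat_prodPoint (Z₀ : TStar n d) {q : (D.Free → ℝ) × (UpperPairs d → ℝ)}
    (hq : q.1 ∈ D.dom) : mat (D.prodPoint hR Z₀ q).1 =
      D.slice q.1 * (R * cayley (skew q.2)).transpose := by
  rw [RowData.prodPoint, mat_act, D.mat_pointD Z₀ hq]

/-- The coordinates of the chart `prodChart`. -/
def RowData.prodCoord (R : Matrix (Fin d) (Fin d) ℝ) (Z : TStar n d) :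
    (D.Free → ℝ) × (UpperPairs d → ℝ) :=
  (D.free (normalMat J Z), upper (cayley (R.transpose * rotation J Z)))

theorem RowData.prodPoint_mem_prodDomain (Z₀ : TStar n d)
    {q : (D.Free → ℝ) × (UpperPairs d → ℝ)} (hq : q.1 ∈ D.dom) :
    D.prodPoint hR Z₀ q ∈ D.prodDomain R := by
  have h1 := rotation_eq_of_isNormal (D.isNormal_slice hq) (mul_cayley_mem hR q.2)
    (D.mat_prodPoint hR Z₀ hq)
  refine ⟨D.mem_domain_of_proj_eq (D.pointD_mem_domain Z₀ hq) (proj_act _ _ _).symm, ?_⟩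
  have h2 : R.transpose * R = 1 := (Matrix.mem_orthogonalGroup_iff' (Fin d) ℝ).1 hR
  rw [h1, ← Matrix.mul_assoc, h2, Matrix.one_mul]
  exact isUnit_det_one_add_cayley (isUnit_det_one_add_of_skew (transpose_skew _))

theorem RowData.prodPoint_prodCoord (Z₀ : TStar n d) {Z : TStar n d} (hZ : Z ∈ D.prodDomain R) :
    D.prodPoint hR Z₀ (D.prodCoord R Z) = Z := by
  have h2 : R * R.transpose = 1 := (Matrix.mem_orthogonalGroup_iff (Fin d) ℝ).1 hR
  have h3 : R.transpose * rotation J Z ∈ Matrix.orthogonalGroup (Fin d) ℝ :=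
    mul_mem (transpose_mem_orthogonalGroup hR) (rotation_mem hZ.1.1)
  have h4 : R * cayley (skew (D.prodCoord R Z).2) = rotation J Z := by
    rw [RowData.prodCoord, skew_upper (transpose_cayley h3 hZ.2), cayley_cayley hZ.2,
      ← Matrix.mul_assoc, h2, Matrix.one_mul]
  have h5 : D.slice (D.prodCoord R Z).1 = normalMat J Z := by
    rw [RowData.prodCoord, D.slice_free_normalMat hZ.1]
  refine Subtype.ext (mat_injective ?_)
  rw [D.mat_prodPoint hR Z₀ (q := D.prodCoord R Z) (D.pointD_free Z₀ hZ.1).1, h4, h5,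
    ← mat_eq_normalMat_mul hZ.1.1]

theorem RowData.prodCoord_prodPoint (Z₀ : TStar n d) {q : (D.Free → ℝ) × (UpperPairs d → ℝ)}
    (hq : q.1 ∈ D.dom) : D.prodCoord R (D.prodPoint hR Z₀ q) = q := by
  have h1 := rotation_eq_of_isNormal (D.isNormal_slice hq) (mul_cayley_mem hR q.2)
    (D.mat_prodPoint hR Z₀ hq)
  have h2 : R.transpose * R = 1 := (Matrix.mem_orthogonalGroup_iff' (Fin d) ℝ).1 hR
  have h3 := normalMat_eq_of_isNormal (D.isNormal_slice hq) (mul_cayley_mem hR q.2)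
    (D.mat_prodPoint hR Z₀ hq)
  rw [RowData.prodCoord, h3, h1, D.free_slice, ← Matrix.mul_assoc, h2, Matrix.one_mul,
    cayley_cayley (isUnit_det_one_add_of_skew (transpose_skew _)), upper_skew]

end NormalForm

/-! ### Smoothness of the normal form and the rotation -/

section Smooth

variable {n d : ℕ} [NeZero d] {J : Lex (Fin d → Fin n)}
  {E H X : Type*} [NormedAddCommGroup E] [NormedSpace ℝ E] [TopologicalSpace H]
  {I : ModelWithCorners ℝ E H} [TopologicalSpace X] [ChartedSpace H X] {x : X}

theorem contMDiffAt_euclideanSpace_iff {k : WithTop ℕ∞} {ι : Type*} [Fintype ι]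
    {f : X → EuclideanSpace ℝ ι} :
    ContMDiffAt I 𝓘(ℝ, EuclideanSpace ℝ ι) k f x ↔
      ∀ j, ContMDiffAt I 𝓘(ℝ, ℝ) k (fun y => f y j) x := by
  constructor
  · intro h j
    exact (EuclideanSpace.proj (𝕜 := ℝ) j).contDiff.contMDiff.contMDiffAt.comp x h
  · intro h
    exact (EuclideanSpace.equiv ι ℝ).symm.contDiff.contMDiff.contMDiffAt.comp x
      (contMDiffAt_pi_space.2 h)

/-- A map into `T*_{n,d}` is smooth iff the entries of the corresponding matrix are. -/
theorem contMDiffAt_tStar_iff {f : X → TStar n d} :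
    ContMDiffAt I (modelT n d) ∞ f x ↔ EntrySmoothAt I (fun y => mat (f y).1) x := by
  rw [← ContMDiffAt.subtypeVal_comp_iff, contMDiffAt_pi_iff]
  simp only [contMDiffAt_sphere_iff, contMDiffAt_euclideanSpace_iff]
  rfl

theorem entrySmoothAt_mat (Z : TStar n d) :
    EntrySmoothAt (modelT n d) (fun Z : TStar n d => mat Z.1) Z :=
  contMDiffAt_tStar_iff.1 contMDiffAt_id

theorem entrySmoothAt_rotation {Z : TStar n d} (h : J ∈ indexSets Z) :
    EntrySmoothAt (modelT n d) (rotation J : TStar n d → _) Z := by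
  have h1 : EntrySmoothAt (modelT n d) (rows J : TStar n d → _) Z :=
    fun i j => entrySmoothAt_mat Z _ _
  have hu := ((mem_indexSets_iff J Z).1 h).2
  exact (h1.inv hu).mul (h1.cholesky hu)

theorem entrySmoothAt_normalMat {Z : TStar n d} (h : J ∈ indexSets Z) :
    EntrySmoothAt (modelT n d) (normalMat J : TStar n d → _) Z :=
  (entrySmoothAt_mat Z).mul (entrySmoothAt_rotation h)

end Smooth

/-! ### Charts from free entries and Cayley coordinates -/

section Charts

variable {n d : ℕ} [NeZero d] {J : Lex (Fin d → Fin n)} (D : RowData J)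

theorem RowData.isOpen_domain : IsOpen D.domain := by
  rw [isOpen_iff_mem_nhds]
  rintro Z ⟨hZ, hp⟩
  refine Filter.inter_mem ((isOpen_setOf_mem_indexSets J).mem_nhds hZ) ?_
  refine Filter.eventually_all.2 fun i => ?_
  have hc := (entrySmoothAt_normalMat hZ i (D.piv i)).continuousAt
  exact (continuousAt_const.mul hc).eventually_const_lt (hp i)

theorem RowData.contMDiffAt_pointD (Z₀ : TStar n d) {x : D.Free → ℝ} (hx : x ∈ D.dom) :
    ContMDiffAt 𝓘(ℝ, D.Free → ℝ) (modelT n d) ∞ (D.pointD Z₀) x := by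
  rw [contMDiffAt_tStar_iff]
  refine EntrySmoothAt.congr (D.entrySmoothAt_slice (x := id)
    (fun p => contMDiffAt_pi_space.1 contMDiffAt_id p) hx) ?_
  filter_upwards [D.isOpen_dom.mem_nhds hx] with y hy
  exact D.mat_pointD Z₀ hy

theorem RowData.continuousOn_free_normalMat :
    ContinuousOn (fun Z : TStar n d => D.free (normalMat J Z)) D.domain := fun _ hZ =>
  (continuousAt_pi.2 fun _ => (entrySmoothAt_normalMat hZ.1 _ _).continuousAt).continuousWithinAt

/-- The chart of `M*_{n,d}` given by the free entries of the normal form. -/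
def RowData.freeChart (Z₀ : TStar n d) : OpenPartialHomeomorph (MStar n d) (D.Free → ℝ) where
  -- On the source the value is independent of the representative, since the normal form is constant
  -- on orbits.
  toFun p := D.free (normalMat J (Quotient.out p))
  invFun x := proj (D.pointD Z₀ x)
  source := {p | Quotient.out p ∈ D.domain}
  target := D.dom
  map_source' p hp := (D.pointD_free Z₀ hp).1
  map_target' x hx := D.mem_domain_of_proj_eq (D.pointD_mem_domain Z₀ hx) (proj_out _).symm
  left_inv' p hp := by
    rw [(D.pointD_free Z₀ hp).2, normalForm, proj_act, proj_out]
  right_inv' x hx := by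
    have h := normalMat_eq_of_proj_eq (D.pointD_mem_domain Z₀ hx).1
      (proj_out (proj (D.pointD Z₀ x))).symm
    rw [← h.2, normalMat_eq_of_isNormal (D.isNormal_slice hx) (one_mem _) (D.mat_pointD_eq Z₀ hx),
      D.free_slice]
  open_source := by
    rw [← isQuotientMap_proj.isOpen_preimage]
    convert D.isOpen_domain using 1
    ext Z
    exact ⟨fun h => D.mem_domain_of_proj_eq h (proj_out _),
      fun h => D.mem_domain_of_proj_eq h (proj_out _).symm⟩
  open_target := D.isOpen_dom
  continuousOn_toFun := by
    have hpre : (proj : TStar n d → MStar n d) ⁻¹' {p | Quotient.out p ∈ D.domain} =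
        D.domain := by
      ext Z
      exact ⟨fun h => D.mem_domain_of_proj_eq h (proj_out _),
        fun h => D.mem_domain_of_proj_eq h (proj_out _).symm⟩
    -- Openness in the quotient is tested upstairs, where the coordinates are continuous functions
    -- of the normal form.
    rw [continuousOn_open_iff]
    · intro t ht
      rw [← isQuotientMap_proj.isOpen_preimage]
      convert D.continuousOn_free_normalMat.isOpen_inter_preimage D.isOpen_domain ht using 1
      rw [Set.preimage_inter, hpre]
      ext Z
      refine and_congr_right fun h => ?_
      simp only [Set.mem_preimage]
      rw [(normalMat_eq_of_proj_eq h.1 (proj_out (proj Z)).symm).2]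
    · rw [← isQuotientMap_proj.isOpen_preimage, hpre]
      exact D.isOpen_domain
  continuousOn_invFun x hx :=
    (isQuotientMap_proj.continuous.continuousAt.comp
      (D.contMDiffAt_pointD Z₀ hx).continuousAt).continuousWithinAt

theorem RowData.freeChart_proj (Z₀ : TStar n d) {Z : TStar n d} (hZ : Z ∈ D.domain) :
    proj Z ∈ (D.freeChart Z₀).source ∧ D.freeChart Z₀ (proj Z) = D.free (normalMat J Z) := by
  refine ⟨D.mem_domain_of_proj_eq hZ (proj_out _).symm, ?_⟩
  exact congrArg D.free (normalMat_eq_of_proj_eq hZ.1 (proj_out (proj Z)).symm).2.symm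

variable {R : Matrix (Fin d) (Fin d) ℝ} (hR : R ∈ Matrix.orthogonalGroup (Fin d) ℝ)

theorem RowData.contMDiffAt_prodPoint (Z₀ : TStar n d) {q : (D.Free → ℝ) × (UpperPairs d → ℝ)}
    (hq : q.1 ∈ D.dom) :
    ContMDiffAt 𝓘(ℝ, (D.Free → ℝ) × (UpperPairs d → ℝ)) (modelT n d) ∞ (D.prodPoint hR Z₀) q := by
  rw [contMDiffAt_tStar_iff]
  have h1 : EntrySmoothAt 𝓘(ℝ, (D.Free → ℝ) × (UpperPairs d → ℝ))
      (fun q : (D.Free → ℝ) × (UpperPairs d → ℝ) => D.slice q.1) q :=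
    D.entrySmoothAt_slice (x := Prod.fst)
      (fun p => contMDiffAt_pi_space.1 contDiff_fst.contMDiff.contMDiffAt p) hq
  have h2 : EntrySmoothAt 𝓘(ℝ, (D.Free → ℝ) × (UpperPairs d → ℝ))
      (fun q : (D.Free → ℝ) × (UpperPairs d → ℝ) => skew q.2) q := fun i j => by
    have h : ∀ p, ContMDiffAt 𝓘(ℝ, (D.Free → ℝ) × (UpperPairs d → ℝ)) 𝓘(ℝ, ℝ) ∞
      (fun q : (D.Free → ℝ) × (UpperPairs d → ℝ) => q.2 p) q :=
        fun p => contMDiffAt_pi_space.1 contDiff_snd.contMDiff.contMDiffAt p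
    simp only [skew, Matrix.of_apply]
    split_ifs
    · exact h _
    · exact (h _).neg
    · exact contMDiffAt_const
  have h3 := h1.mul ((entrySmoothAt_const R).mul
    (h2.cayley (isUnit_det_one_add_of_skew (transpose_skew q.2)))).transpose
  refine h3.congr ?_
  filter_upwards [(D.isOpen_dom.preimage continuous_fst).mem_nhds hq] with y hy
  exact D.mat_prodPoint hR Z₀ hy

theorem RowData.contMDiffAt_prodCoord {Z : TStar n d} (hZ : Z ∈ D.prodDomain R) :
    ContMDiffAt (modelT n d) 𝓘(ℝ, (D.Free → ℝ) × (UpperPairs d → ℝ)) ∞ (D.prodCoord R) Z := by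
  refine ContMDiffAt.prodMk_space (contMDiffAt_pi_space.2 fun p => ?_)
    (contMDiffAt_pi_space.2 fun p => ?_)
  · exact entrySmoothAt_normalMat hZ.1.1 _ _
  · exact ((entrySmoothAt_const R.transpose).mul (entrySmoothAt_rotation hZ.1.1)).cayley hZ.2 _ _

theorem RowData.isOpen_prodDomain : IsOpen (D.prodDomain R) := by
  rw [isOpen_iff_mem_nhds]
  rintro Z ⟨hZ, hu⟩
  refine Filter.inter_mem (D.isOpen_domain.mem_nhds hZ) ?_
  have h := (((entrySmoothAt_const (1 : Matrix (Fin d) (Fin d) ℝ)).add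
    ((entrySmoothAt_const R.transpose).mul (entrySmoothAt_rotation hZ.1))).det).continuousAt
  exact (h.eventually_ne hu.ne_zero).mono fun y hy => isUnit_iff_ne_zero.2 hy

/-- The chart of `T*_{n,d}` given by the free entries of the normal form and the Cayley transform of
the rotation relative to `R`. -/
def RowData.prodChart (Z₀ : TStar n d) :
    OpenPartialHomeomorph (TStar n d) ((D.Free → ℝ) × (UpperPairs d → ℝ)) where
  toFun := D.prodCoord R
  invFun := D.prodPoint hR Z₀
  source := D.prodDomain R
  target := {q | q.1 ∈ D.dom}
  map_source' _ hZ := (D.pointD_free Z₀ hZ.1).1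
  map_target' _ hq := D.prodPoint_mem_prodDomain hR Z₀ hq
  left_inv' _ hZ := D.prodPoint_prodCoord hR Z₀ hZ
  right_inv' _ hq := D.prodCoord_prodPoint hR Z₀ hq
  open_source := D.isOpen_prodDomain
  open_target := D.isOpen_dom.preimage continuous_fst
  continuousOn_toFun _ hZ := (D.contMDiffAt_prodCoord hZ).continuousAt.continuousWithinAt
  continuousOn_invFun _ hq := (D.contMDiffAt_prodPoint hR Z₀ hq).continuousAt.continuousWithinAt

end Charts

/-! ### Transfer of the charts to the model spaces -/

section ModelCharts

variable {n d : ℕ} {J : Lex (Fin d → Fin n)} (D : RowData J)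

/-- The free entries as a model of `M*_{n,d}`. -/
def RowData.baseEquiv : (D.Free → ℝ) ≃L[ℝ] EuclideanSpace ℝ (Fin (dimM n d)) :=
  ContinuousLinearEquiv.ofFinrankEq (by
    rw [Module.finrank_fintype_fun_eq_card, D.card_free, finrank_euclideanSpace_fin])

/-- The splitting of the model of `T*_{n,d}`. -/
def RowData.totalEquiv : (Fin n → EuclideanSpace ℝ (Fin (d - 1))) ≃L[ℝ]
    EuclideanSpace ℝ (Fin (dimM n d)) × (UpperPairs d → ℝ) :=
  ContinuousLinearEquiv.ofFinrankEq (by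
    rw [Module.finrank_prod, Module.finrank_fintype_fun_eq_card, finrank_euclideanSpace_fin,
      ← D.card_free, D.card_free_add, Module.finrank_pi_fintype]
    simp)

/-- The `J`-rows of the normal form have positive diagonal pivots, and every other row, being a unit
vector, has some nonzero entry whose sign can be recorded. Hence the charts cover. -/
theorem exists_rowData {Z : TStar n d} (h : J ∈ indexSets Z) :
    ∃ D : RowData J, Z ∈ D.domain := by
  have hJ := ((mem_indexSets_iff J Z).1 h).1
  have hN := isNormal_normalMat h
  have key : ∀ i : Fin n, ∃ (m : Fin d) (s : ℝ), s * s = 1 ∧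
      (∀ a, i = ofLex J a → m = a ∧ s = 1) ∧ 0 < s * normalMat J Z i m := fun i => by
    by_cases hi : ∃ a, i = ofLex J a
    · obtain ⟨a, rfl⟩ := hi
      refine ⟨a, 1, one_mul 1, fun b hb => ⟨hJ.injective hb, rfl⟩, ?_⟩
      rw [one_mul]
      exact hN.pos a
    · have hne : ∃ m, normalMat J Z i m ≠ 0 := by
        by_contra! hz
        have h1 := normalMat_dot_self h i
        rw [Matrix.mul_apply, Finset.sum_eq_zero fun j _ => by rw [hz j, zero_mul]] at h1
        exact zero_ne_one h1
      obtain ⟨m, hm⟩ := hne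
      rcases lt_or_gt_of_ne hm with hm | hm
      · exact ⟨m, -1, by norm_num, fun a ha => absurd ⟨a, ha⟩ hi, by linarith⟩
      · exact ⟨m, 1, by norm_num, fun a ha => absurd ⟨a, ha⟩ hi, by linarith⟩
  choose m s h1 h2 h3 using key
  exact ⟨⟨hJ, m, s, h1, fun a => (h2 _ a rfl).1, fun a => (h2 _ a rfl).2⟩, h, h3⟩

/-- The homeomorphism from the coordinates of `prodChart` to the model space of `T*_{n,d}`. -/
def RowData.modelHomeo : ((D.Free → ℝ) × (UpperPairs d → ℝ)) ≃ₜ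
    ModelPi (fun _ : Fin n => EuclideanSpace ℝ (Fin (d - 1))) :=
  ((D.baseEquiv.prodCongr (.refl ℝ _)).trans D.totalEquiv.symm).toHomeomorph.trans
    (modelT n d).toHomeomorph.symm

theorem RowData.contMDiff_modelHomeo :
    ContMDiff 𝓘(ℝ, (D.Free → ℝ) × (UpperPairs d → ℝ)) (modelT n d) ∞ D.modelHomeo := by
  have h1 : ContMDiff 𝓘(ℝ, Fin n → EuclideanSpace ℝ (Fin (d - 1))) (modelT n d) ∞
      (modelT n d).symm := by
    have := (modelT n d).contMDiffOn_symm (n := ∞)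
    rwa [(modelT n d).range_eq_univ, contMDiffOn_univ] at this
  exact h1.comp ((D.baseEquiv.prodCongr (.refl ℝ _)).trans D.totalEquiv.symm).contDiff.contMDiff

theorem RowData.contMDiff_modelHomeo_symm :
    ContMDiff (modelT n d) 𝓘(ℝ, (D.Free → ℝ) × (UpperPairs d → ℝ)) ∞ D.modelHomeo.symm :=
  ((D.baseEquiv.prodCongr (.refl ℝ _)).trans D.totalEquiv.symm).symm.contDiff.contMDiff.comp
    (modelT n d).contMDiff

theorem lexMin_mem (Y : TStar n d) : lexMin Y ∈ indexSets Y :=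
  WellFounded.min_mem _ _ _

variable [NeZero d]

/-- The chart `freeChart` with values in the model space. -/
def RowData.chartM (Z₀ : TStar n d) :
    OpenPartialHomeomorph (MStar n d) (EuclideanSpace ℝ (Fin (dimM n d))) :=
  (D.freeChart Z₀).transHomeomorph D.baseEquiv.toHomeomorph

theorem RowData.proj_mem_chartM_source (Z₀ : TStar n d) {Z : TStar n d} :
    proj Z ∈ (D.chartM Z₀).source ↔ Z ∈ D.domain :=
  ⟨fun h => D.mem_domain_of_proj_eq h (proj_out _), fun h => (D.freeChart_proj Z₀ h).1⟩

theorem RowData.chartM_proj (Z₀ : TStar n d) {Z : TStar n d} (hZ : Z ∈ D.domain) :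
    D.chartM Z₀ (proj Z) = D.baseEquiv (D.free (normalMat J Z)) :=
  congrArg D.baseEquiv (D.freeChart_proj Z₀ hZ).2

variable {R : Matrix (Fin d) (Fin d) ℝ} (hR : R ∈ Matrix.orthogonalGroup (Fin d) ℝ)

/-- The chart `prodChart` with values in the model space. -/
def RowData.chartT (Z₀ : TStar n d) :
    OpenPartialHomeomorph (TStar n d) (ModelPi fun _ : Fin n => EuclideanSpace ℝ (Fin (d - 1))) :=
  (D.prodChart hR Z₀).transHomeomorph D.modelHomeo

/-- After `totalEquiv`, the first component is the base coordinate of `proj Z` when `Z` lies in the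
domain, so `proj` reads as the first projection. -/
theorem RowData.model_chartT (Z₀ Z : TStar n d) :
    modelT n d (D.chartT hR Z₀ Z) = D.totalEquiv.symm
      (D.baseEquiv (D.free (normalMat J Z)), upper (cayley (R.transpose * rotation J Z))) :=
  (modelT n d).toHomeomorph.apply_symm_apply _

instance : IsManifold (modelT n d) ∞ (T n d) :=
  haveI : IsManifold (𝓡 (d - 1)) ∞ (Metric.sphere (0 : EuclideanSpace ℝ (Fin d)) 1) :=
    .of_le (n := ω) le_top
  isManifold_pi

theorem RowData.chartT_mem_maximalAtlas (Z₀ : TStar n d) :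
    D.chartT hR Z₀ ∈ IsManifold.maximalAtlas (modelT n d) ∞ (TStar n d) := by
  refine OpenPartialHomeomorph.mem_maximalAtlas_of_contMDiffOn _ ?_ ?_
  · intro Z hZ
    exact ((D.contMDiff_modelHomeo _).comp Z (D.contMDiffAt_prodCoord hZ)).contMDiffWithinAt
  · intro y hy
    exact (ContMDiffAt.comp y (D.contMDiffAt_prodPoint hR Z₀ hy)
      (D.contMDiff_modelHomeo_symm y)).contMDiffWithinAt

end ModelCharts

/-! ### Existence of the quotient structure -/

section BaseAtlas

variable {n d : ℕ} [NeZero d]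

theorem exists_chartM (p : MStar n d) :
    ∃ (J : Lex (Fin d → Fin n)) (D : RowData J) (Z₀ : TStar n d), p ∈ (D.chartM Z₀).source := by
  obtain ⟨D, hD⟩ := exists_rowData (lexMin_mem (Quotient.out p))
  exact ⟨_, D, Quotient.out p, hD⟩

variable (n d) in
/-- The atlas of `M*_{n,d}` of the charts given by free entries of normal forms. -/
@[reducible] def baseAtlas : AtlasM n d where
  atlas := {e | ∃ (J : Lex (Fin d → Fin n)) (D : RowData J) (Z₀ : TStar n d), e = D.chartM Z₀}
  chartAt p := (exists_chartM p).choose_spec.choose.chartM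
    (exists_chartM p).choose_spec.choose_spec.choose
  mem_chart_source p := (exists_chartM p).choose_spec.choose_spec.choose_spec
  chart_mem_atlas _ := ⟨_, _, _, rfl⟩

/-- A transition map lifts to `T*`: it sends free entries smoothly to a normal form for `J`, and
then takes free entries of the normal form for `J'`, which is smooth in the point. -/
theorem isSmoothAtlas_baseAtlas : IsSmoothAtlas (baseAtlas n d) := by
  let _ := baseAtlas n d
  refine isManifold_of_contDiffOn _ _ _ ?_
  rintro _ _ ⟨J, D, Z₀, rfl⟩ ⟨J', D', Z₀', rfl⟩
  intro u hu
  obtain ⟨⟨hu1, hu2⟩, -⟩ := hu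
  have hdom : D.baseEquiv.symm u ∈ D.dom := hu1
  have hs : ∀ u, (D.chartM Z₀).symm u ∈ (D'.chartM Z₀').source ↔
      D.pointD Z₀ (D.baseEquiv.symm u) ∈ D'.domain := fun u => D'.proj_mem_chartM_source Z₀'
  have hpt : ContMDiffAt (𝓡 (dimM n d)) (modelT n d) ∞
      (fun u => D.pointD Z₀ (D.baseEquiv.symm u)) u :=
    ContMDiffAt.comp u (D.contMDiffAt_pointD Z₀ hdom)
      D.baseEquiv.symm.contDiff.contMDiff.contMDiffAt
  have hmem := (hs u).1 hu2
  have hfree : ContMDiffAt (𝓡 (dimM n d)) (𝓡 (dimM n d)) ∞ (fun u => D'.baseEquiv (D'.free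
      (normalMat J' (D.pointD Z₀ (D.baseEquiv.symm u))))) u := by
    refine D'.baseEquiv.contDiff.contMDiff.contMDiffAt.comp u (contMDiffAt_pi_space.2 fun p => ?_)
    exact ContMDiffAt.comp u (g := fun Z => normalMat J' Z p.1.1 p.1.2)
      (entrySmoothAt_normalMat hmem.1 p.1.1 p.1.2) hpt
  refine ((contMDiffAt_iff_contDiffAt.1 hfree).congr_of_eventuallyEq ?_).contDiffWithinAt
  filter_upwards [hpt.continuousAt (D'.isOpen_domain.mem_nhds hmem)] with v hv
  exact D'.chartM_proj Z₀' hv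

theorem RowData.chartM_mem_diffStructure {J : Lex (Fin d → Fin n)} (D : RowData J)
    (Z₀ : TStar n d) : D.chartM Z₀ ∈ diffStructure (baseAtlas n d) := by
  let _ := baseAtlas n d
  have : IsManifold (𝓡 (dimM n d)) ∞ (MStar n d) := isSmoothAtlas_baseAtlas
  exact IsManifold.subset_maximalAtlas ⟨J, D, Z₀, rfl⟩

theorem isQuotientAtlas_baseAtlas : IsQuotientAtlas (baseAtlas n d) := by
  let _ := baseAtlas n d
  refine ⟨isSmoothAtlas_baseAtlas, Manifold.IsSubmersionOfComplement.isSubmersion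
    (F := UpperPairs d → ℝ) fun Z => ?_⟩
  have hZ := lexMin_mem Z
  obtain ⟨D, hD⟩ := exists_rowData hZ
  -- With the rotation of `Z` itself as reference, the relative rotation at `Z` is `1`, where the
  -- Cayley transform is defined.
  have hR := rotation_mem hZ
  have hmem : Z ∈ (D.chartT hR Z).source := by
    refine ⟨hD, ?_⟩
    have h : (rotation (lexMin Z) Z).transpose * rotation (lexMin Z) Z = 1 :=
      (Matrix.mem_orthogonalGroup_iff' (Fin d) ℝ).1 hR
    rw [h]
    exact isUnit_det_one_add_one
  refine Manifold.IsSubmersionAtOfComplement.mk_of_charts D.totalEquiv (D.chartT hR Z) (D.chartM Z)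
    hmem ((D.proj_mem_chartM_source Z).2 hD) (D.chartT_mem_maximalAtlas hR Z)
    (D.chartM_mem_diffStructure Z) (fun W hW => (D.proj_mem_chartM_source Z).2 hW.1) ?_
  intro y hy
  set W := ((D.chartT hR Z).extend (modelT n d)).symm y with hW
  have hWs : W ∈ (D.chartT hR Z).source := by
    have := ((D.chartT hR Z).extend (modelT n d)).map_target hy
    rwa [OpenPartialHomeomorph.extend_source] at this
  have hy' : y = modelT n d (D.chartT hR Z W) :=
    (((D.chartT hR Z).extend (modelT n d)).right_inv hy).symm
  change D.chartM Z (proj W) = (D.totalEquiv y).1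
  rw [hy', D.model_chartT, ContinuousLinearEquiv.apply_symm_apply, D.chartM_proj Z hWs.1]

end BaseAtlas

/-! ### Transport of manifold structures and restriction of charts -/

section Transport

variable {E H M N : Type*} [NormedAddCommGroup E] [NormedSpace ℝ E] [TopologicalSpace H]
  {I : ModelWithCorners ℝ E H} [TopologicalSpace M] [TopologicalSpace N] {k : WithTop ℕ∞}

/-- The charted space structure transported along a homeomorphism. -/
@[reducible] def transportedChartedSpace [ChartedSpace H M] (h : M ≃ₜ N) : ChartedSpace H N where
  atlas := {e | ∃ e' ∈ atlas H M, e = h.symm.toOpenPartialHomeomorph.trans e'}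
  chartAt y := h.symm.toOpenPartialHomeomorph.trans (chartAt H (h.symm y))
  mem_chart_source y := by simp
  chart_mem_atlas y := ⟨_, chart_mem_atlas H _, rfl⟩

/-- A manifold structure can be transported along a homeomorphism, which becomes a
diffeomorphism. -/
theorem exists_diffeomorph_of_homeomorph [ChartedSpace H M] [IsManifold I k M] (h : M ≃ₜ N) :
    ∃ _ : ChartedSpace H N, IsManifold I k N ∧
      ∃ Φ : Diffeomorph I I M N k, ∀ x, Φ x = h x := by
  let _ : ChartedSpace H N := transportedChartedSpace h
  have hN : IsManifold I k N := by
    refine isManifold_of_contDiffOn _ _ _ ?_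
    rintro _ _ ⟨e, he, rfl⟩ ⟨e', he', rfl⟩
    have hc := (contDiffGroupoid k I).compatible he he'
    rw [contDiffGroupoid, mem_groupoid_of_pregroupoid] at hc
    have h1 : ContDiffOn ℝ k (I ∘ (e.symm.trans e') ∘ I.symm)
      (I.symm ⁻¹' (e.symm.trans e').source ∩ Set.range I) := hc.1
    refine (h1.mono ?_).congr ?_
    · rintro x ⟨hx, hx'⟩
      refine ⟨?_, hx'⟩
      simpa using hx
    · intro x _
      simp
  have h1 : ∀ x : M, ContMDiffAt I I k h x := fun x => by
    rw [contMDiffAt_iff]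
    refine ⟨h.continuous.continuousAt, ?_⟩
    -- The chart of `N` at `h x` is the chart of `M` at `x` after `h.symm`, so `h` is the identity
    -- in coordinates.
    refine contDiffWithinAt_id.congr_of_eventuallyEq_of_mem ?_ (Set.mem_range_self _)
    filter_upwards [extChartAt_target_mem_nhdsWithin (I := I) x] with y hy
    have hch : (chartAt H (h x) : OpenPartialHomeomorph N H) =
        h.symm.toOpenPartialHomeomorph.trans (chartAt H x) := by
      change h.symm.toOpenPartialHomeomorph.trans (chartAt H (h.symm (h x))) = _
      rw [h.symm_apply_apply]
    have hy' := (extChartAt I x).right_inv hy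
    simpa [extChartAt, hch] using hy'
  have h2 : ∀ y : N, ContMDiffAt I I k h.symm y := fun y => by
    rw [contMDiffAt_iff]
    refine ⟨h.symm.continuous.continuousAt, ?_⟩
    refine contDiffWithinAt_id.congr_of_eventuallyEq_of_mem ?_ (Set.mem_range_self _)
    filter_upwards [extChartAt_target_mem_nhdsWithin (I := I) y] with z hz
    exact (extChartAt I y).right_inv hz
  exact ⟨_, hN, ⟨h.toEquiv, h1, h2⟩, fun _ => rfl⟩

/-- The restriction of a chart of the maximal atlas to an open subset. -/
theorem subtypeRestr_mem_maximalAtlas [ChartedSpace H M] [IsManifold I ∞ M]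
    {e : OpenPartialHomeomorph M H} (he : e ∈ IsManifold.maximalAtlas I ∞ M)
    {U : TopologicalSpace.Opens M} (hU : Nonempty U) :
    e.subtypeRestr hU ∈ IsManifold.maximalAtlas I ∞ U := by
  refine OpenPartialHomeomorph.mem_maximalAtlas_of_contMDiffOn _ ?_ ?_
  · intro x hx
    rw [OpenPartialHomeomorph.subtypeRestr_source] at hx
    exact ((contMDiffAt_of_mem_maximalAtlas he hx).comp x
      (contMDiff_subtype_val x)).contMDiffWithinAt
  · intro y hy
    refine ContMDiffAt.contMDiffWithinAt ?_
    rw [← ContMDiffAt.subtypeVal_comp_iff]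
    have hy' : y ∈ e.target := e.subtypeRestr_target_subset hU hy
    refine (contMDiffAt_symm_of_mem_maximalAtlas he hy').congr_of_eventuallyEq ?_
    filter_upwards [(e.subtypeRestr hU).open_target.mem_nhds hy] with z hz
    exact e.subtypeRestr_symm_apply hU hz

end Transport

/-! ### Uniqueness of the quotient structure -/

section Quotient

variable {n d : ℕ}

/-- The identity of `M*_{n,d}` is smooth from the atlas `c` to the atlas `c'`. -/
def SmoothId (c c' : AtlasM n d) : Prop :=
  @ContMDiff ℝ _ _ _ _ _ _ (𝓡 (dimM n d)) (MStar n d) _ c _ _ _ _ _ (𝓡 (dimM n d)) (MStar n d) _ c'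
    ∞ id

theorem diffStructure_eq {c c' : AtlasM n d} (hc : IsSmoothAtlas c) (hc' : IsSmoothAtlas c')
    (h : SmoothId c c') (h' : SmoothId c' c) : diffStructure c = diffStructure c' :=
  Set.Subset.antisymm (maximalAtlas_subset_of_contMDiff_id c c' hc' h h')
    (maximalAtlas_subset_of_contMDiff_id c' c hc h' h)

variable [NeZero d]

/-- The projection is smooth with respect to the atlas `c`. -/
def SmoothProj (c : AtlasM n d) : Prop :=
  letI := c
  ContMDiff (modelT n d) (𝓡 (dimM n d)) ∞ (proj : TStar n d → MStar n d)

theorem IsQuotientAtlas.smoothProj {c : AtlasM n d} (hc : IsQuotientAtlas c) : SmoothProj c :=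
  letI := c
  hc.2.contMDiff

/-- A map is smooth for the quotient structure if its composition with the projection is. -/
theorem IsQuotientAtlas.contMDiff_of_comp {E H X : Type*} [NormedAddCommGroup E] [NormedSpace ℝ E]
    [TopologicalSpace H] {I : ModelWithCorners ℝ E H} [TopologicalSpace X] [ChartedSpace H X]
    {c : AtlasM n d} (hc : IsQuotientAtlas c) {g : MStar n d → X}
    (hg : ContMDiff (modelT n d) I ∞ (g ∘ proj)) :
    letI := c
    ContMDiff (𝓡 (dimM n d)) I ∞ g := by
  let _ := c
  intro p
  obtain ⟨F, _, _, hF⟩ := hc.2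
  have h := contMDiffAt_of_comp_submersion (hF (Quotient.out p)) (hg _)
  rwa [proj_out] at h

theorem IsQuotientAtlas.smoothId {c c' : AtlasM n d} (hc : IsQuotientAtlas c)
    (hc' : SmoothProj c') : SmoothId c c' :=
  @IsQuotientAtlas.contMDiff_of_comp n d _ _ _ (MStar n d) _ _ _ (𝓡 (dimM n d)) _ c' c hc id hc'

theorem IsQuotientAtlas.diffStructure_eq {c c' : AtlasM n d} (hc : IsQuotientAtlas c)
    (hc' : IsQuotientAtlas c') : diffStructure c = diffStructure c' :=
  LowRankCorrelation.diffStructure_eq hc.1 hc'.1 (hc.smoothId hc'.smoothProj)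
    (hc'.smoothId hc.smoothProj)

theorem IsQuotientAtlas.of_diffStructure_eq {c c' : AtlasM n d} (hc : IsQuotientAtlas c)
    (hc' : IsSmoothAtlas c') (h : diffStructure c = diffStructure c') : IsQuotientAtlas c' := by
  refine ⟨hc', ?_⟩
  -- The submersion property is spelled out so that `c` enters only through its maximal atlas, which
  -- can then be rewritten.
  have key : ∃ (F : Type) (_ : NormedAddCommGroup F) (_ : NormedSpace ℝ F), ∀ Z : TStar n d,
      ∃ (e : (Fin n → EuclideanSpace ℝ (Fin (d - 1))) ≃L[ℝ]
          EuclideanSpace ℝ (Fin (dimM n d)) × F)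
        (φ : OpenPartialHomeomorph (TStar n d)
          (ModelPi fun _ : Fin n => EuclideanSpace ℝ (Fin (d - 1))))
        (ψ : OpenPartialHomeomorph (MStar n d) (EuclideanSpace ℝ (Fin (dimM n d)))),
        Z ∈ φ.source ∧ proj Z ∈ ψ.source ∧
        φ ∈ IsManifold.maximalAtlas (modelT n d) ∞ (TStar n d) ∧ ψ ∈ diffStructure c ∧
        φ.source ⊆ proj ⁻¹' ψ.source ∧
        Set.EqOn (ψ.extend (𝓡 (dimM n d)) ∘ proj ∘ (φ.extend (modelT n d)).symm) (Prod.fst ∘ e)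
          (φ.extend (modelT n d)).target := by
    let _ := c
    obtain ⟨F, _, _, hF⟩ := hc.2
    exact ⟨F, _, _, fun Z => ⟨(hF Z).equiv, (hF Z).domChart, (hF Z).codChart,
      (hF Z).mem_domChart_source, (hF Z).mem_codChart_source, (hF Z).domChart_mem_maximalAtlas,
      (hF Z).codChart_mem_maximalAtlas, (hF Z).source_subset_preimage_source,
      (hF Z).writtenInCharts⟩⟩
  rw [h] at key
  obtain ⟨F, _, _, hF⟩ := key
  let _ := c'
  refine ⟨F, inferInstance, inferInstance, fun Z => ?_⟩
  obtain ⟨e, φ, ψ, h1, h2, h3, h4, h5, h6⟩ := hF Z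
  exact Manifold.IsSubmersionAtOfComplement.mk_of_charts e φ ψ h1 h2 h3 h4 h5 h6

end Quotient

/-! ### The sections characterize the quotient structure -/

section Section

variable {n d : ℕ}

theorem proj_mem_chartDomain (Y : TStar n d) : proj Y ∈ chartDomain Y := ⟨Y, rfl, lexMin_mem Y⟩

theorem proj_sec (Y : TStar n d) (p : chartDomain Y) : proj (sec Y p) = p := by
  rw [sec, normalForm, proj_act]
  exact p.2.choose_spec.1

theorem proj_mem_chartDomain_of_mem_range {Y S : TStar n d} (h : S ∈ Set.range (sec Y)) :
    proj S ∈ chartDomain Y := by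
  obtain ⟨p, rfl⟩ := h
  rw [proj_sec]
  exact p.2

theorem mem_indexSets_of_proj_mem {Y Z : TStar n d} (h : proj Z ∈ chartDomain Y) :
    lexMin Y ∈ indexSets Z := by
  obtain ⟨W, hW, hm⟩ := h
  exact (normalMat_eq_of_proj_eq hm hW).1

theorem mat_sec_eq {Y Z : TStar n d} (h : proj Z ∈ chartDomain Y) :
    mat (sec Y ⟨proj Z, h⟩).1 = normalMat (lexMin Y) Z := by
  have h1 := sec_proj Y Z (mem_indexSets_of_proj_mem h)
  rw [h1, mat_normalForm]

/-- The points of the image of the section are their own normal forms. -/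
theorem rotation_sec (Y : TStar n d) (p : chartDomain Y) : rotation (lexMin Y) (sec Y p) = 1 := by
  obtain ⟨p, Z, rfl, hZ⟩ := p
  refine rotation_eq_of_isNormal (isNormal_normalMat hZ) (one_mem _) ?_
  rw [Matrix.transpose_one, Matrix.mul_one]
  exact mat_sec_eq _

variable [NeZero d]

theorem RowData.sec_eq {Y : TStar n d} (D : RowData (lexMin Y)) (Z₀ : TStar n d)
    {p : chartDomain Y} (hp : (p : MStar n d) ∈ (D.freeChart Z₀).source) :
    sec Y p = D.pointD Z₀ (D.freeChart Z₀ p) := by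
  obtain ⟨p, Z, rfl, hZ⟩ := p
  have hZD : Z ∈ D.domain := D.mem_domain_of_proj_eq hp (proj_out _)
  rw [(D.freeChart_proj Z₀ hZD).2, (D.pointD_free Z₀ hZD).2]
  exact sec_proj Y Z hZ

theorem continuous_sec (Y : TStar n d) : Continuous (sec Y) := by
  rw [continuous_iff_continuousAt]
  intro p
  obtain ⟨D, hD⟩ := exists_rowData (mem_indexSets_of_proj_mem (Y := Y) (Z := Quotient.out p.1)
    (by rw [proj_out]; exact p.2))
  have hp : (p : MStar n d) ∈ (D.freeChart Y).source := hD
  have h1 : ContinuousAt (fun q : chartDomain Y => D.pointD Y (D.freeChart Y q)) p :=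
    ContinuousAt.comp (f := fun q : chartDomain Y => D.freeChart Y q)
      (D.contMDiffAt_pointD Y ((D.freeChart Y).map_source hp)).continuousAt
      (((D.freeChart Y).continuousAt hp).comp continuous_subtype_val.continuousAt)
  refine h1.congr ?_
  filter_upwards [continuous_subtype_val.continuousAt.preimage_mem_nhds
    ((D.freeChart Y).open_source.mem_nhds hp)] with q hq
  exact (D.sec_eq Y hq).symm

/-- The section as a homeomorphism onto its image. -/
def secHomeo (Y : TStar n d) : chartDomain Y ≃ₜ Set.range (sec Y) where
  toFun p := ⟨sec Y p, p, rfl⟩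
  invFun s := ⟨proj s.1, proj_mem_chartDomain_of_mem_range s.2⟩
  left_inv p := Subtype.ext (proj_sec Y p)
  right_inv := by
    rintro ⟨_, p, rfl⟩
    refine Subtype.ext (congrArg (sec Y) (Subtype.ext (proj_sec Y p)))
  continuous_toFun := (continuous_sec Y).subtype_mk _
  continuous_invFun :=
    (isQuotientMap_proj.continuous.comp continuous_subtype_val).subtype_mk _

/-- The image receives the structure transported by `secHomeo`. Its points have rotation `1`, and
`cayley 1 = 0`, so in the product chart with reference `1` the inclusion is `u ↦ (u, 0)`, an
immersion. -/
theorem IsQuotientAtlas.sectionIsDiffeo {c : AtlasM n d} (hc : IsQuotientAtlas c)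
    (Y : TStar n d) : SectionIsDiffeo c Y := by
  have hds := isQuotientAtlas_baseAtlas.diffStructure_eq hc
  let _ := c
  have : IsManifold (𝓡 (dimM n d)) ∞ (MStar n d) := hc.1
  obtain ⟨cS, hS, Φ, hΦ⟩ := exists_diffeomorph_of_homeomorph (I := 𝓡 (dimM n d)) (k := ∞)
    (secHomeo Y)
  refine ⟨cS, hS, ⟨Manifold.IsImmersionOfComplement.isImmersion (F := UpperPairs d → ℝ) fun s => ?_,
    Topology.IsEmbedding.subtypeVal⟩, Φ, fun p => by rw [hΦ]; rfl⟩
  have hsymm : ∀ s, Φ.symm s = (secHomeo Y).symm s := fun s => by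
    exact Φ.injective (((Φ.apply_symm_apply s).trans
      ((secHomeo Y).apply_symm_apply s).symm).trans (hΦ _).symm)
  have hmem : ∀ s : Set.range (sec Y), lexMin Y ∈ indexSets s.1 ∧ rotation (lexMin Y) s.1 = 1 := by
    rintro ⟨_, p, rfl⟩
    exact ⟨mem_indexSets_of_proj_mem (by rw [proj_sec]; exact p.2), rotation_sec Y p⟩
  obtain ⟨D, hD⟩ := exists_rowData (hmem s).1
  let e := (D.chartM Y).subtypeRestr (s := chartDomain Y) ⟨(secHomeo Y).symm s⟩
  let e' := (secHomeo Y).symm.toOpenPartialHomeomorph.trans e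
  have he : e ∈ IsManifold.maximalAtlas (𝓡 (dimM n d)) ∞ (chartDomain Y) := by
    have hm : D.chartM Y ∈ diffStructure c := hds ▸ D.chartM_mem_diffStructure Y
    exact subtypeRestr_mem_maximalAtlas hm _
  have he' : e' ∈ IsManifold.maximalAtlas (𝓡 (dimM n d)) ∞ (Set.range (sec Y)) := by
    refine mem_maximalAtlas_of_contMDiff Φ.contMDiff Φ.symm.contMDiff he ?_ ?_ ?_ ?_
    · intro q hq
      rw [hsymm]
      exact hq.2
    · intro q hq
      simp only [Function.comp_apply, hsymm]
      rfl
    · intro u hu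
      exact hu.1
    · intro u hu
      simp only [Function.comp_apply, hΦ]
      rfl
  have hsrc : ∀ q : Set.range (sec Y), q ∈ e'.source ↔ q.1 ∈ D.domain := fun q => by
    rw [← D.proj_mem_chartM_source Y]
    simp only [e', e, OpenPartialHomeomorph.trans_source, OpenPartialHomeomorph.subtypeRestr_source]
    exact and_iff_right (Set.mem_univ _)
  have hcoe : ∀ q : Set.range (sec Y), e' q = D.chartM Y (proj q.1) := fun q => rfl
  refine Manifold.IsImmersionAtOfComplement.mk_of_continuousAt
    continuous_subtype_val.continuousAt D.totalEquiv.symm e' (D.chartT (one_mem _) Y)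
    ((hsrc s).2 hD) ⟨hD, ?_⟩ he' (D.chartT_mem_maximalAtlas _ Y) ?_
  · rw [(hmem s).2, Matrix.transpose_one, one_mul]
    exact isUnit_det_one_add_one
  · intro u hu
    set q := (e'.extend (𝓡 (dimM n d))).symm u
    have hq : q ∈ e'.source := by
      have := (e'.extend (𝓡 (dimM n d))).map_target hu
      rwa [OpenPartialHomeomorph.extend_source] at this
    have hu' : u = e' q := ((e'.extend (𝓡 (dimM n d))).right_inv hu).symm
    have hqD := (hsrc q).1 hq
    change modelT n d (D.chartT (one_mem _) Y q.1) = D.totalEquiv.symm (u, 0)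
    rw [D.model_chartT, (hmem q).2, Matrix.transpose_one, one_mul, cayley_one, hu', hcoe,
      D.chartM_proj Y hqD]
    rfl

/-- Near `Z`, the projection is the normal form map `f` into the image of the section, followed by
the inverse of the section. -/
theorem smoothProj_of_sectionIsDiffeo {c : AtlasM n d} (h : ∀ Y : TStar n d, SectionIsDiffeo c Y) :
    SmoothProj c := by
  let _ := c
  intro Z
  obtain ⟨cS, hS, hι, Φ, hΦ⟩ := h Z
  have hZ := proj_mem_chartDomain Z
  classical
  let f : TStar n d → Set.range (sec Z) := fun W =>
    if h : proj W ∈ chartDomain Z then ⟨sec Z ⟨proj W, h⟩, _, rfl⟩ else ⟨sec Z ⟨proj Z, hZ⟩, _, rfl⟩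
  have hev : ∀ᶠ W in nhds Z, proj W ∈ chartDomain Z :=
    isQuotientMap_proj.continuous.continuousAt ((chartDomain Z).isOpen.mem_nhds hZ)
  have hf : ContMDiffAt (modelT n d) (modelT n d) ∞ (Subtype.val ∘ f) Z := by
    rw [contMDiffAt_tStar_iff]
    refine (entrySmoothAt_normalMat (lexMin_mem Z)).congr (hev.mono fun W hW => ?_)
    simp only [Function.comp_apply, f, dif_pos hW]
    exact mat_sec_eq hW
  -- Smoothness into `T*` passes to the image because the inclusion is an immersion and `f` is
  -- continuous for the subspace topology.
  have hf' : ContMDiffAt (modelT n d) (𝓡 (dimM n d)) ∞ f Z :=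
    (ContMDiffAt.iff_comp_isImmersionAt (hι.isImmersion.isImmersionAt _)).2
      ⟨Topology.IsInducing.subtypeVal.continuousAt_iff.2 hf.continuousAt, hf⟩
  have h1 : ContMDiffAt (modelT n d) (𝓡 (dimM n d)) ∞ (fun W => (Φ.symm (f W) : MStar n d)) Z :=
    (contMDiff_subtype_val _).comp Z ((Φ.symm.contMDiff _).comp Z hf')
  refine h1.congr_of_eventuallyEq (hev.mono fun W hW => ?_)
  have h2 : f W = Φ ⟨proj W, hW⟩ := by
    refine Subtype.ext ?_
    rw [hΦ]
    simp only [f, dif_pos hW]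
  simp only [h2, Diffeomorph.symm_apply_apply]

/-- On each chart domain `g` equals `(g ∘ proj) ∘ sec`, and the section is smooth into `T*`. -/
theorem contMDiff_of_sectionIsDiffeo {E H X : Type*} [NormedAddCommGroup E] [NormedSpace ℝ E]
    [TopologicalSpace H] {I : ModelWithCorners ℝ E H} [TopologicalSpace X] [ChartedSpace H X]
    {c : AtlasM n d} (h : ∀ Y : TStar n d, SectionIsDiffeo c Y) {g : MStar n d → X}
    (hg : ContMDiff (modelT n d) I ∞ (g ∘ proj)) :
    letI := c
    ContMDiff (𝓡 (dimM n d)) I ∞ g := by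
  let _ := c
  intro p
  obtain ⟨Z, rfl⟩ : ∃ Z, proj Z = p := ⟨_, proj_out p⟩
  obtain ⟨cS, hS, hι, Φ, hΦ⟩ := h Z
  have h1 : ContMDiff (𝓡 (dimM n d)) I ∞ ((g ∘ proj) ∘ Subtype.val ∘ Φ) :=
    hg.comp (hι.contMDiff.comp Φ.contMDiff)
  have h2 : (g ∘ proj) ∘ Subtype.val ∘ Φ = fun q : chartDomain Z => g q := by
    funext q
    simp only [Function.comp_apply, hΦ, proj_sec]
  rw [h2] at h1
  exact contMDiffAt_subtype_iff.1 (h1 ⟨proj Z, proj_mem_chartDomain Z⟩)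

theorem smoothId_of_sectionIsDiffeo {c c' : AtlasM n d} (hc' : SmoothProj c')
    (h : ∀ Y : TStar n d, SectionIsDiffeo c Y) : SmoothId c c' :=
  @contMDiff_of_sectionIsDiffeo n d _ _ _ (MStar n d) _ _ _ (𝓡 (dimM n d)) _ c' c h id hc'

theorem isQuotientAtlas_iff {c : AtlasM n d} (hc : IsSmoothAtlas c) :
    IsQuotientAtlas c ↔ ∀ Y : TStar n d, SectionIsDiffeo c Y := by
  refine ⟨fun h Y => h.sectionIsDiffeo Y, fun h => ?_⟩
  have h0 : IsQuotientAtlas (baseAtlas n d) := isQuotientAtlas_baseAtlas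
  exact h0.of_diffStructure_eq hc (diffStructure_eq h0.1 hc
    (h0.smoothId (smoothProj_of_sectionIsDiffeo h)) (smoothId_of_sectionIsDiffeo h0.smoothProj h))

end Section

end

end LowRankCorrelation

theorem mainTheorem7 (n d : ℕ) [NeZero d] :
    (∀ Y : TStar n d, proj Y ∈ chartDomain Y ∧ ∀ p : chartDomain Y, proj (sec Y p) = p) ∧
    (∃ c : AtlasM n d, IsQuotientAtlas c) ∧
    (∀ c c' : AtlasM n d, IsQuotientAtlas c → IsQuotientAtlas c' →
      diffStructure c = diffStructure c') ∧
    (∀ c : AtlasM n d, IsSmoothAtlas c →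
      (IsQuotientAtlas c ↔ ∀ Y : TStar n d, SectionIsDiffeo c Y)) := by
  exact ⟨fun Y => ⟨proj_mem_chartDomain Y, proj_sec Y⟩, ⟨baseAtlas n d, isQuotientAtlas_baseAtlas⟩,
    fun _ _ hc hc' => hc.diffStructure_eq hc', fun _ hc => isQuotientAtlas_iff hc⟩
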